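/- For $n\ge 0$ let $(a;q)_n=\prod_{k=0}^{n-1}(1-aq^k)$. Let $q=e^{2\pi i\tau}$ with $\mathrm{Im}\,\tau>0$, where $q^r$ means $e^{2\pi i r\tau}$ for rational $r$. For $u,v,w\in\mathbb{C}$ and $\sigma\in\{0,1\}$ define $$F(u,v,w;q)=\sum_{i,j,k\ge 0}\frac{q^{\frac12 i^2+j^2+2k^2+ik+2jk}\,u^iv^jw^k}{(q;q)_i\,(q;q)_j\,(q^2;q^2)_k},$$ $$G_\sigma(u,v,w;q)=\sum_{\substack{i,j,k\ge 0\\ i\equiv\sigma\ (\mathrm{mod}\ 2)}}\frac{q^{i^2+2j^2+k^2+2ij+ik}\,u^iv^jw^k}{(q;q)_i\,(q^2;q^2)_j\,(q^2;q^2)_k},$$ and the column vectors $$U(\tau)=\Big(q^{-\frac{5}{88}}F(1,1,1;q),\ q^{-\frac{1}{88}}F(1,1,q;q),\ q^{\frac{7}{88}}\big(F(1,q,q;q)+qF(q,q^2,q^3;q)\big),\ q^{\frac{19}{88}}F(1,q,q^2;q),\ q^{\frac{35}{88}}F(q,q,q^2;q)\Big)^{\mathrm T},$$ $$V(\tau)=\Big(q^{-\frac{7}{88}}G_0(1,1,1;q),\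 q^{\frac{25}{88}}\big(G_0(q,1,1;q)+G_1(q^3,q^2,q;q)\big),\ q^{\frac{1}{88}}G_1(1,1,q;q),\ q^{\frac{9}{88}}G_1(q,1,q;q),\ q^{\frac{49}{88}}G_1(q^2,q^2,q;q)\Big)^{\mathrm T}.$$ Then all these series converge absolutely, and for every $\tau$ with $\mathrm{Im}\,\tau>0$, $$V\left(-\frac{1}{2\tau}\right)=S\,U(\tau)\quad\text{and}\quad U\left(-\frac{1}{\tau}\right)=2S\,V\left(\frac{\tau}{2}\right),$$ where $$S=\begin{pmatrix} \alpha_5 & \alpha_4 & \alpha_3 & \alpha_2 & \alpha_1\\ \alpha_4 & \alpha_1 & -\alpha_2 & -\alpha_5 & -\alpha_3\\ \alpha_3 & -\alpha_2 & -\alpha_4 & \alpha_1 & \alpha_5\\ \alpha_2 & -\alpha_5 & \alpha_1 & \alpha_3 & -\alpha_4\\ \alpha_1 & -\alpha_3 & \alpha_5 & -\alpha_4 & \alpha_2 \end{pmatrix},\qquad \alpha_k=\sqrt{\tfrac{2}{11}}\,\sin\frac{k\pi}{11}.$$ -/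

import Mathlib

open scoped Matrix

namespace MizunoNahm

noncomputable section

/-- The power `q ^ r` with `q = e^(2 π i τ)`, that is `e^(2 π i r τ)`, for a rational exponent. -/
def qpow (τ : ℂ) (r : ℚ) : ℂ :=
  Complex.exp (2 * (Real.pi : ℂ) * Complex.I * (r : ℂ) * τ)

/-- The variable `q = e^(2 π i τ)`. -/
def qvar (τ : ℂ) : ℂ :=
  Complex.exp (2 * (Real.pi : ℂ) * Complex.I * τ)

/-- The finite `q`-shifted factorial `(a; q)_n = ∏_{0 ≤ k < n} (1 - a q^k)`. -/
def qPoch (a q : ℂ) (n : ℕ) : ℂ :=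
  ∏ k ∈ Finset.range n, (1 - a * q ^ k)

/-- The `(i, j, k)` term of the Nahm sum `F(u, v, w; q)` of index `(1, 1, 2)`. -/
def termF (u v w τ : ℂ) (n : ℕ × ℕ × ℕ) : ℂ :=
  let q := qvar τ
  let i := n.1
  let j := n.2.1
  let k := n.2.2
  qpow τ ((i : ℚ) ^ 2 / 2 + (j : ℚ) ^ 2 + 2 * (k : ℚ) ^ 2 + i * k + 2 * j * k)
      * u ^ i * v ^ j * w ^ k
    / (qPoch q q i * qPoch q q j * qPoch (q ^ 2) (q ^ 2) k)

/-- The Nahm sum `F(u, v, w; q)`, with `q = e^(2 π i τ)`. -/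
def F (u v w τ : ℂ) : ℂ :=
  ∑' n : ℕ × ℕ × ℕ, termF u v w τ n

/-- The `(i, j, k)` term of the Nahm sums of index `(1, 2, 2)`. -/
def termG (u v w τ : ℂ) (n : ℕ × ℕ × ℕ) : ℂ :=
  let q := qvar τ
  let i := n.1
  let j := n.2.1
  let k := n.2.2
  q ^ (i ^ 2 + 2 * j ^ 2 + k ^ 2 + 2 * i * j + i * k) * u ^ i * v ^ j * w ^ k
    / (qPoch q q i * qPoch (q ^ 2) (q ^ 2) j * qPoch (q ^ 2) (q ^ 2) k)

/-- The partial Nahm sum `G_σ(u, v, w; q)`, with `q = e^(2 π i τ)`: the sum over the triples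
`(i, j, k)` with `i ≡ σ (mod 2)`. -/
def G (σ : ℕ) (u v w τ : ℂ) : ℂ :=
  ∑' n : {n : ℕ × ℕ × ℕ // n.1 ≡ σ [MOD 2]}, termG u v w τ n

/-- The vector of Nahm sums of index `(1, 1, 2)`. -/
def U (τ : ℂ) : Fin 5 → ℂ :=
  let q := qvar τ
  ![qpow τ (-5 / 88) * F 1 1 1 τ,
    qpow τ (-1 / 88) * F 1 1 q τ,
    qpow τ (7 / 88) * (F 1 q q τ + q * F q (q ^ 2) (q ^ 3) τ),
    qpow τ (19 / 88) * F 1 q (q ^ 2) τ,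
    qpow τ (35 / 88) * F q q (q ^ 2) τ]

/-- The vector of (partial) Nahm sums of index `(1, 2, 2)`. -/
def V (τ : ℂ) : Fin 5 → ℂ :=
  let q := qvar τ
  ![qpow τ (-7 / 88) * G 0 1 1 1 τ,
    qpow τ (25 / 88) * (G 0 q 1 1 τ + G 1 (q ^ 3) (q ^ 2) q τ),
    qpow τ (1 / 88) * G 1 1 1 q τ,
    qpow τ (9 / 88) * G 1 q 1 q τ,
    qpow τ (49 / 88) * G 1 (q ^ 2) (q ^ 2) q τ]

/-- `α_k = √(2/11) sin(k π / 11)`. -/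
def α (k : ℕ) : ℂ :=
  ((Real.sqrt (2 / 11) * Real.sin ((k : ℝ) * Real.pi / 11) : ℝ) : ℂ)

/-- The transformation matrix. -/
def S : Matrix (Fin 5) (Fin 5) ℂ :=
  !![α 5, α 4, α 3, α 2, α 1;
     α 4, α 1, -α 2, -α 5, -α 3;
     α 3, -α 2, -α 4, α 1, α 5;
     α 2, -α 5, α 1, α 3, -α 4;
     α 1, -α 3, α 5, -α 4, α 2]

end

end MizunoNahm

/-! ### q-shifted factorials and the kernel form of Bailey's lemma -/

namespace MizunoNahm
open Filter Topology

/-! Every entry of `U` and `V` is a quotient of two weight-1/2 theta series, so the transformation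
formulas reduce to Poisson summation.

In a Nahm sum one index enters only through an Euler series, whose sum is an infinite product over a
finite one (`eulerSum_eq`). Because `j² + 2k² + 2jk = (j+k)² + k²`, what remains is a two-fold
Bailey chain (`tsum_eq_baileyChain`) whose seed is one of Slater's pairs: type G in base `q` for `F`
(`inv_eq_baileySum_G`), type C in base `q²` for `G_σ` (`inv_eq_baileySum_C`). Each Bailey step adds
4 to the quadratic coefficient of the theta exponent, `3 → 7 → 11`, and the linear coefficient ends
at 1, 3, 5, 7 or 9. The entries that are sums of two series are those where only a combination of
two chains collapses to a single theta series (`baileyChain_G_add`, `baileyChain_C_add`). The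
infinite product in front is the reciprocal of a theta series, by a finite Jacobi triple product
(`qPochInf_mul_tsum_thetaTerm`).

With `θ(t, x) = ∑ (-1)^r e^(πi t (r+x)²)` and `c = 1, 3, 5, 7, 9`, this gives `U = θ(11τ/2, c/22) /
θ(2τ, 1/4)` and `V = θ(44τ, c/22) / θ(4τ, 1/4)` (`U_eq`, `V_eq`). The functional equation of
`jacobiTheta₂`, followed by splitting the dual series modulo 11 and modulo 2, transforms numerator
and denominator. The automorphy factors cancel, and the coefficients left are the cosines that make
up `S` (`S_apply`). This is the formula for `U(-1/τ)`; the one for `V` follows since `S · 2S = 1`.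
-/

lemma qPoch_succ (a q : ℂ) (n : ℕ) : qPoch a q (n + 1) = qPoch a q n * (1 - a * q ^ n) :=
  Finset.prod_range_succ _ _

@[simp] lemma qPoch_zero (a q : ℂ) : qPoch a q 0 = 1 := Finset.prod_range_zero _

lemma one_sub_mul_pow_ne_zero {a q : ℂ} (ha : ‖a‖ < 1) (hq : ‖q‖ < 1) (n : ℕ) :
    1 - a * q ^ n ≠ 0 := by
  intro h
  have h1 : ‖a * q ^ n‖ = 1 := by rw [← sub_eq_zero.mp h]; simp
  rw [norm_mul, norm_pow] at h1
  have : ‖q‖ ^ n ≤ 1 := pow_le_one₀ (norm_nonneg _) hq.le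
  nlinarith [norm_nonneg a]

lemma qPoch_ne_zero {a q : ℂ} (ha : ‖a‖ < 1) (hq : ‖q‖ < 1) (n : ℕ) : qPoch a q n ≠ 0 :=
  Finset.prod_ne_zero_iff.mpr fun k _ => one_sub_mul_pow_ne_zero ha hq k

lemma summable_norm_mul_pow (a : ℂ) {q : ℂ} (hq : ‖q‖ < 1) :
    Summable fun k : ℕ => ‖-(a * q ^ k)‖ := by
  simpa [norm_mul, norm_pow] using
    (summable_geometric_of_lt_one (norm_nonneg q) hq).mul_left ‖a‖

/-- The infinite `q`-shifted factorial `(a; q)_∞`. -/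
noncomputable def qPochInf (a q : ℂ) : ℂ := ∏' k : ℕ, (1 - a * q ^ k)

lemma tendsto_qPoch (a : ℂ) {q : ℂ} (hq : ‖q‖ < 1) :
    Tendsto (qPoch a q) atTop (𝓝 (qPochInf a q)) := by
  have h : Multipliable fun k : ℕ => 1 + -(a * q ^ k) :=
    multipliable_one_add_of_summable (summable_norm_mul_pow a hq)
  have h2 := h.hasProd.tendsto_prod_nat
  simp only [← sub_eq_add_neg] at h2
  exact h2

lemma qPochInf_ne_zero {a q : ℂ} (ha : ‖a‖ < 1) (hq : ‖q‖ < 1) : qPochInf a q ≠ 0 := by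
  have := tprod_one_add_ne_zero_of_summable (f := fun k : ℕ => -(a * q ^ k))
    (fun k => by simpa [← sub_eq_add_neg] using one_sub_mul_pow_ne_zero ha hq k)
    (summable_norm_mul_pow a hq)
  simpa [qPochInf, sub_eq_add_neg] using this

lemma exists_norm_qPoch_inv_le {a q : ℂ} (ha : ‖a‖ < 1) (hq : ‖q‖ < 1) :
    ∃ M : ℝ, 0 < M ∧ ∀ n, ‖(qPoch a q n)⁻¹‖ ≤ M := by
  have h := (tendsto_qPoch a hq).inv₀ (qPochInf_ne_zero ha hq)
  obtain ⟨M, hM⟩ := (Metric.isBounded_range_of_tendsto _ h).exists_norm_le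
  refine ⟨max M 1, by positivity, fun n => (hM _ ⟨n, rfl⟩).trans (le_max_left _ _)⟩

/-- The reciprocal `1 / (q; q)_n`, extended by zero to negative `n`. -/
noncomputable def invPoch (q : ℂ) (n : ℤ) : ℂ := if 0 ≤ n then (qPoch q q n.toNat)⁻¹ else 0

@[simp] lemma invPoch_natCast (q : ℂ) (n : ℕ) : invPoch q n = (qPoch q q n)⁻¹ := by
  simp [invPoch]

@[simp] lemma invPoch_zero (q : ℂ) : invPoch q 0 = 1 := by simp [invPoch]

lemma invPoch_of_neg (q : ℂ) {n : ℤ} (hn : n < 0) : invPoch q n = 0 := by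
  simp [invPoch, hn]

/-- Extension by zero makes the recurrence valid at every integer, including `n = 0`, so boundary
terms need no separate treatment in the sums below. -/
lemma one_sub_zpow_mul_invPoch {q : ℂ} (hq : ‖q‖ < 1) (n : ℤ) :
    (1 - q ^ n) * invPoch q n = invPoch q (n - 1) := by
  rcases lt_trichotomy n 0 with h | rfl | h
  · rw [invPoch_of_neg q h, invPoch_of_neg q (by lia), mul_zero]
  · rw [invPoch_of_neg q (show (0 : ℤ) - 1 < 0 by simp)]; simp
  · obtain ⟨m, rfl⟩ : ∃ m : ℕ, n = ((m + 1 : ℕ) : ℤ) := ⟨(n - 1).toNat, by lia⟩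
    have h1 := one_sub_mul_pow_ne_zero hq hq m
    have h2 := qPoch_ne_zero hq hq m
    rw [show ((m + 1 : ℕ) : ℤ) - 1 = (m : ℕ) by simp, invPoch_natCast, invPoch_natCast, qPoch_succ,
      zpow_natCast, pow_succ', mul_inv]
    field_simp

lemma exists_norm_invPoch_le {q : ℂ} (hq : ‖q‖ < 1) :
    ∃ M : ℝ, 0 < M ∧ ∀ n, ‖invPoch q n‖ ≤ M := by
  obtain ⟨M, hM, h⟩ := exists_norm_qPoch_inv_le hq hq
  refine ⟨M, hM, fun n => ?_⟩
  unfold invPoch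
  split_ifs
  · exact h _
  · simpa using hM.le

lemma tendsto_invPoch_add {q : ℂ} (hq : ‖q‖ < 1) (s : ℤ) :
    Tendsto (fun n : ℕ => invPoch q (n + s)) atTop (𝓝 (qPochInf q q)⁻¹) := by
  have h := (tendsto_qPoch q hq).inv₀ (qPochInf_ne_zero hq hq)
  have h2 : Tendsto (fun n : ℕ => ((n : ℤ) + s).toNat) atTop atTop :=
    tendsto_atTop_mono' _ (by
      filter_upwards [eventually_ge_atTop s.natAbs] with n hn
      show n - s.natAbs ≤ _
      lia) (tendsto_sub_atTop_nat s.natAbs)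
  refine (h.comp h2).congr' ?_
  filter_upwards [eventually_ge_atTop s.natAbs] with n hn
  simp [invPoch, show (0 : ℤ) ≤ n + s by lia]

/-- The `q`-Chu–Vandermonde summation in the form used for Bailey pairs. -/
lemma sum_qVandermonde {q : ℂ} (hq : ‖q‖ < 1) (N b : ℕ) :
    ∑ t ∈ Finset.range (N + 1), q ^ (t ^ 2 + b * t) * invPoch q ((N : ℤ) - t) * invPoch q t *
      invPoch q (t + b) = invPoch q N * invPoch q (N + b) := by
  induction N generalizing b with
  | zero => simp
  | succ N ih =>
    have hne : (1 - q ^ ((N + 1 : ℕ) : ℤ)) ≠ 0 := by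
      rw [zpow_natCast, pow_succ']; exact one_sub_mul_pow_ne_zero hq hq N
    apply mul_left_cancel₀ hne
    -- Multiplied by `1 - q^(N+1)`, both sides satisfy `S(N+1, b) = S(N, b) + q^(N+b+1) S(N, b+1)`;
    -- hence the induction over all `b` at once.
    have e1 : (1 - q ^ ((N + 1 : ℕ) : ℤ)) * (invPoch q ((N + 1 : ℕ) : ℤ) *
        invPoch q (((N + 1 : ℕ) : ℤ) + b)) = invPoch q N * invPoch q ((N : ℤ) + b)
        + q ^ (N + b + 1) * (invPoch q N * invPoch q ((N : ℤ) + (b + 1 : ℕ))) := by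
      have h1 := one_sub_zpow_mul_invPoch hq ((N + 1 : ℕ) : ℤ)
      have h2 := one_sub_zpow_mul_invPoch hq (((N + 1 : ℕ) : ℤ) + b)
      rw [show ((N + 1 : ℕ) : ℤ) - 1 = N by simp] at h1
      rw [show ((N + 1 : ℕ) : ℤ) + b - 1 = (N : ℤ) + b by push_cast; ring] at h2
      rw [show ((N + 1 : ℕ) : ℤ) + b = ((N + b + 1 : ℕ) : ℤ) by push_cast; ring] at h2 ⊢
      rw [show (N : ℤ) + ((b + 1 : ℕ) : ℤ) = ((N + b + 1 : ℕ) : ℤ) by push_cast; ring, ← h1, ← h2,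
        zpow_natCast, zpow_natCast]
      ring
    rw [e1, ← ih b, ← ih (b + 1), Finset.mul_sum, Finset.mul_sum]
    -- Termwise this is `1 - q^(N+1) = (1 - q^(N+1-t)) + q^(N+1-t) (1 - q^t)`; each bracket lowers
    -- one reciprocal factorial.
    have key : ∀ t ∈ Finset.range (N + 1 + 1),
        (1 - q ^ ((N + 1 : ℕ) : ℤ)) * (q ^ (t ^ 2 + b * t) * invPoch q (((N + 1 : ℕ) : ℤ) - t) *
          invPoch q t * invPoch q (t + b)) =
        q ^ (t ^ 2 + b * t) * invPoch q ((N : ℤ) - t) * invPoch q t * invPoch q (t + b) +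
        q ^ (N + 1 - t) * (q ^ (t ^ 2 + b * t) * invPoch q (((N + 1 : ℕ) : ℤ) - t) *
          invPoch q ((t : ℤ) - 1) * invPoch q (t + b)) := by
      intro t ht
      have ht' : t ≤ N + 1 := by simpa [Nat.lt_succ_iff] using ht
      have h1 := one_sub_zpow_mul_invPoch hq (((N + 1 : ℕ) : ℤ) - t)
      have h2 := one_sub_zpow_mul_invPoch hq (t : ℤ)
      rw [show ((N + 1 : ℕ) : ℤ) - t - 1 = (N : ℤ) - t by push_cast; ring] at h1
      rw [← h1, ← h2, zpow_natCast, zpow_natCast,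
        show ((N + 1 : ℕ) : ℤ) - (t : ℤ) = ((N + 1 - t : ℕ) : ℤ) by lia, zpow_natCast]
      have h3 : q ^ (N + 1) = q ^ (N + 1 - t) * q ^ t := by rw [← pow_add]; congr 1; lia
      rw [h3]; ring
    rw [Finset.sum_congr rfl key, Finset.sum_add_distrib]
    congr 1
    · rw [Finset.sum_range_succ, invPoch_of_neg q (show (N : ℤ) - ((N + 1 : ℕ) : ℤ) < 0 by simp)]
      simp
    · rw [Finset.sum_range_succ']
      rw [invPoch_of_neg q (show ((0 : ℕ) : ℤ) - 1 < 0 by simp)]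
      simp only [mul_zero, zero_mul, add_zero]
      refine Finset.sum_congr rfl fun t ht => ?_
      have ht' : t ≤ N := by simpa [Nat.lt_succ_iff] using ht
      rw [show ((N + 1 : ℕ) : ℤ) - ((t + 1 : ℕ) : ℤ) = (N : ℤ) - t by push_cast; ring,
        show ((t + 1 : ℕ) : ℤ) - 1 = t by simp,
        show ((t + 1 : ℕ) : ℤ) + b = (t : ℤ) + (b + 1 : ℕ) by push_cast; ring]
      have : q ^ (N + 1 - (t + 1)) * q ^ ((t + 1) ^ 2 + b * (t + 1)) =
          q ^ (N + b + 1) * q ^ (t ^ 2 + (b + 1) * t) := by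
        obtain ⟨d, rfl⟩ := Nat.exists_eq_add_of_le ht'
        rw [← pow_add, ← pow_add, show t + d + 1 - (t + 1) = d by lia]
        congr 1; ring
      linear_combination (invPoch q ((N : ℤ) - t) * invPoch q t *
        invPoch q ((t : ℤ) + (b + 1 : ℕ))) * this

/-- The kernel `1 / ((q; q)_{n - s} (q; q)_{n + s + a})` of a Bailey pair. -/
noncomputable def baileyKer (q : ℂ) (a n s : ℤ) : ℂ := invPoch q (n - s) * invPoch q (n + s + a)

/-- The involution `s ↦ -a - s` swaps the two factors. Most of the cancellations below pair this
symmetry with an antisymmetric coefficient. -/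
lemma baileyKer_reflect (q : ℂ) (a n s : ℤ) : baileyKer q a n (-a - s) = baileyKer q a n s := by
  unfold baileyKer
  rw [mul_comm]
  congr 2 <;> ring

lemma baileyKer_eq_zero (q : ℂ) {a n s : ℤ} (h : n < s ∨ n + s + a < 0) : baileyKer q a n s = 0 := by
  unfold baileyKer
  rcases h with h | h
  · rw [invPoch_of_neg q (by lia), zero_mul]
  · rw [invPoch_of_neg q h, mul_zero]

/-- Bailey's lemma on a single kernel: the substitution `m = s + t` turns it into q-Vandermonde with
`N = n - s` and `b = 2s + a`. -/
lemma sum_baileyKer_of_nonneg {q : ℂ} (hq : ‖q‖ < 1) (n a s : ℕ) :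
    ∑ m ∈ Finset.range (n + 1), q ^ (m ^ 2 + a * m) * invPoch q ((n : ℤ) - m) * baileyKer q a m s =
      q ^ (s ^ 2 + a * s) * baileyKer q a n s := by
  rcases lt_or_ge n s with h | h
  · rw [baileyKer_eq_zero q (by lia), mul_zero]
    refine Finset.sum_eq_zero fun m hm => ?_
    have : m < n + 1 := by simpa using hm
    rw [baileyKer_eq_zero q (by lia), mul_zero]
  · obtain ⟨N, rfl⟩ := Nat.exists_eq_add_of_le h
    have h0 := sum_qVandermonde hq N (2 * s + a)
    rw [show s + N + 1 = s + (N + 1) by ring, Finset.sum_range_add]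
    have hz : ∑ x ∈ Finset.range s, q ^ (x ^ 2 + a * x) * invPoch q (((s + N : ℕ) : ℤ) - x) *
        baileyKer q a x s = 0 := by
      refine Finset.sum_eq_zero fun m hm => ?_
      have : m < s := by simpa using hm
      rw [baileyKer_eq_zero q (by lia), mul_zero]
    rw [hz, zero_add]
    unfold baileyKer
    rw [show ((s + N : ℕ) : ℤ) - s = N by push_cast; ring,
      show ((s + N : ℕ) : ℤ) + s + a = N + ((2 * s + a : ℕ) : ℤ) by push_cast; ring, ← h0,
      Finset.mul_sum]
    refine Finset.sum_congr rfl fun t _ => ?_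
    rw [show ((s + N : ℕ) : ℤ) - ((s + t : ℕ) : ℤ) = N - t by push_cast; ring,
      show ((s + t : ℕ) : ℤ) - s = t by push_cast; ring,
      show ((s + t : ℕ) : ℤ) + s + a = t + ((2 * s + a : ℕ) : ℤ) by push_cast; ring]
    have : q ^ ((s + t) ^ 2 + a * (s + t)) = q ^ (s ^ 2 + a * s) * q ^ (t ^ 2 + (2 * s + a) * t) := by
      rw [← pow_add]; congr 1; ring
    rw [this]; ring

/-- Reflection covers `s ≤ -a`. For `-a < s < 0` the kernel is already nonzero at some negative `m`,
which the sum omits, so that gap is excluded. -/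
lemma sum_baileyKer {q : ℂ} (hq : ‖q‖ < 1) (n a : ℕ) {s : ℤ} (hs : 0 ≤ s ∨ s ≤ -a) :
    ∑ m ∈ Finset.range (n + 1), q ^ (m ^ 2 + a * m) * invPoch q ((n : ℤ) - m) * baileyKer q a m s =
      q ^ (s ^ 2 + a * s) * baileyKer q a n s := by
  rcases hs with hs | hs
  · lift s to ℕ using hs
    rw [sum_baileyKer_of_nonneg hq, ← zpow_natCast]
    push_cast; rfl
  · obtain ⟨t, rfl⟩ : ∃ t : ℕ, s = -a - t := ⟨(-a - s).toNat, by lia⟩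
    simp_rw [baileyKer_reflect]
    rw [sum_baileyKer_of_nonneg hq, ← zpow_natCast]
    congr 2; push_cast; ring

end MizunoNahm
-- Bailey transforms of bilateral sequences and their limits
namespace MizunoNahm
open Filter Topology

lemma baileyKer_lower {q : ℂ} (hq : ‖q‖ < 1) (a n s : ℤ) :
    (1 - q ^ (n + s + (a + 1))) * baileyKer q (a + 1) n s = baileyKer q a n s := by
  unfold baileyKer
  rw [mul_left_comm, one_sub_zpow_mul_invPoch hq]
  congr 2; ring

lemma baileyKer_pred {q : ℂ} (hq : ‖q‖ < 1) (a n s : ℤ) :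
    (1 - q ^ (n - s)) * baileyKer q a n s = baileyKer q (a + 1) (n - 1) s := by
  unfold baileyKer
  rw [← mul_assoc, one_sub_zpow_mul_invPoch hq]
  congr 2 <;> ring

lemma exists_norm_baileyKer_le {q : ℂ} (hq : ‖q‖ < 1) :
    ∃ M : ℝ, 0 < M ∧ ∀ a n s, ‖baileyKer q a n s‖ ≤ M := by
  obtain ⟨M, hM, h⟩ := exists_norm_invPoch_le hq
  refine ⟨M * M, by positivity, fun a n s => ?_⟩
  rw [baileyKer, norm_mul]
  exact mul_le_mul (h _) (h _) (norm_nonneg _) hM.le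

lemma tsum_int_reflect (f : ℤ → ℂ) (c : ℤ) : ∑' r, f (c - r) = ∑' r, f r :=
  (Equiv.subLeft c).tsum_eq f

/-- No summability is required: reindexing and negation commute with `tsum` even at its default
value. -/
lemma tsum_eq_zero_of_reflect {f : ℤ → ℂ} (c : ℤ) (h : ∀ r, f (c - r) = -f r) : ∑' r, f r = 0 := by
  have h1 := tsum_int_reflect f c
  simp_rw [h, tsum_neg] at h1
  linear_combination (-1 / 2 : ℂ) * h1

/-- The kernel vanishes unless `-n - a ≤ d r ≤ n`, so the support is finite whatever `x` is. -/
lemma summable_mul_baileyKer (q : ℂ) (a n : ℤ) {d : ℤ} (hd : d ≠ 0) (x : ℤ → ℂ) :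
    Summable fun r => x r * baileyKer q a n (d * r) := by
  refine summable_of_hasFiniteSupport
    ((Set.finite_Icc (-(|n| + |a|)) (|n| + |a|)).subset fun r hr => ?_)
  by_contra hc
  apply hr
  have h1 : |n| + |a| < |r| := by
    by_contra h
    exact hc (abs_le.mp (not_lt.mp h))
  have h2 : |r| ≤ |d * r| := by
    rw [abs_mul]
    have : 1 ≤ |d| := Int.one_le_abs hd
    nlinarith [abs_nonneg r]
  show x r * _ = 0
  rw [baileyKer_eq_zero, mul_zero]
  rcases abs_cases (d * r) with h | h <;> rcases abs_cases n with h' | h' <;>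
    rcases abs_cases a with h'' | h'' <;> lia

/-- The Bailey transform `∑_r x_r / ((q; q)_{n - d r} (q; q)_{n + d r + a})`. -/
noncomputable def baileySum (q : ℂ) (a d : ℤ) (x : ℤ → ℂ) (n : ℤ) : ℂ :=
  ∑' r, x r * baileyKer q a n (d * r)

/-- Raising the parameter `a` when `x_r q^{d r}` is antisymmetric. -/
lemma baileySum_succ_eq {q : ℂ} (hq : ‖q‖ < 1) (h0 : q ≠ 0) (a c : ℤ) {d : ℤ} (hd : d ≠ 0)
    (hc : d * c = -(a + 1)) {x : ℤ → ℂ}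
    (hx : ∀ r, x (c - r) * q ^ (d * (c - r)) = -(x r * q ^ (d * r))) (n : ℤ) :
    baileySum q (a + 1) d x n = baileySum q a d x n := by
  have hz : ∑' r, (x r * q ^ (d * r)) * baileyKer q (a + 1) n (d * r) = 0 := by
    refine tsum_eq_zero_of_reflect c fun r => ?_
    rw [hx, show d * (c - r) = -(a + 1) - d * r by linear_combination hc, baileyKer_reflect]
    ring
  have h1 := summable_mul_baileyKer q (a + 1) n hd x
  have h2 := summable_mul_baileyKer q (a + 1) n hd fun r => x r * q ^ (d * r)
  -- Expanding `1 - q^(n+a+1) q^(dr)` in `baileyKer_lower` leaves the wanted term plus a multiple of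
  -- the antisymmetric sum `hz`.
  have e : ∀ r, x r * baileyKer q a n (d * r) = x r * baileyKer q (a + 1) n (d * r) -
      q ^ (n + (a + 1)) * ((x r * q ^ (d * r)) * baileyKer q (a + 1) n (d * r)) := fun r => by
    rw [← baileyKer_lower hq, show n + d * r + (a + 1) = (n + (a + 1)) + d * r by ring,
      zpow_add₀ h0]
    ring
  unfold baileySum
  rw [tsum_congr e, h1.tsum_sub (h2.mul_left _), tsum_mul_left, hz]
  simp

lemma sum_baileySum {q : ℂ} (hq : ‖q‖ < 1) (a : ℕ) {d : ℤ} (hd : d ≠ 0)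
    (hs : ∀ r, 0 ≤ d * r ∨ d * r ≤ -a) (x : ℤ → ℂ) (n : ℕ) :
    ∑ m ∈ Finset.range (n + 1), q ^ (m ^ 2 + a * m) * invPoch q ((n : ℤ) - m) *
      baileySum q a d x m =
      baileySum q a d (fun r => x r * q ^ ((d * r) ^ 2 + a * (d * r))) n := by
  unfold baileySum
  simp_rw [← tsum_mul_left]
  rw [← Summable.tsum_finsetSum]
  · refine tsum_congr fun r => ?_
    rw [mul_assoc, ← sum_baileyKer hq n a (hs r), Finset.mul_sum]
    exact Finset.sum_congr rfl fun m _ => by ring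
  · intro m _
    exact (summable_mul_baileyKer q a m hd x).mul_left _

lemma norm_pow_sq_add_le {q : ℂ} (hq : ‖q‖ < 1) (n k : ℕ) : ‖q ^ (n ^ 2 + k)‖ ≤ ‖q‖ ^ n := by
  rw [norm_pow]
  exact pow_le_pow_of_le_one (norm_nonneg _) hq.le (by nlinarith)

/-- The limit `N → ∞` of the finite identity: the right side acquires `(q; q)_∞⁻²`, the left side
`(q; q)_∞⁻¹`, and one factor cancels. -/
lemma tsum_baileyKer {q : ℂ} (hq : ‖q‖ < 1) (a : ℕ) {s : ℤ} (hs : 0 ≤ s ∨ s ≤ -a) :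
    ∑' n : ℕ, q ^ (n ^ 2 + a * n) * baileyKer q a n s =
      (qPochInf q q)⁻¹ * q ^ (s ^ 2 + a * s) := by
  obtain ⟨M, hM, hMb⟩ := exists_norm_invPoch_le hq
  have hne := qPochInf_ne_zero hq hq
  have hlim : ∀ s : ℤ, Tendsto (fun N : ℕ => invPoch q ((N : ℤ) - s)) atTop
      (𝓝 (qPochInf q q)⁻¹) := fun s => by
    simpa [sub_eq_add_neg] using tendsto_invPoch_add hq (-s)
  have h1 : Tendsto (fun N : ℕ => ∑' m : ℕ, q ^ (m ^ 2 + a * m) * invPoch q ((N : ℤ) - m) *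
      baileyKer q a m s) atTop
      (𝓝 (∑' m : ℕ, q ^ (m ^ 2 + a * m) * (qPochInf q q)⁻¹ * baileyKer q a m s)) := by
    refine tendsto_tsum_of_dominated_convergence
      (bound := fun m => ‖q‖ ^ m * (M * (M * M))) ?_ ?_ ?_
    · exact (summable_geometric_of_lt_one (norm_nonneg q) hq).mul_right _
    · exact fun m => ((hlim m).const_mul _).mul_const _
    · refine Eventually.of_forall fun N m => ?_
      rw [mul_assoc, norm_mul, norm_mul, baileyKer, norm_mul]
      have := hMb ((N : ℤ) - m)
      have := hMb ((m : ℤ) - s)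
      have := hMb ((m : ℤ) + s + a)
      gcongr
      exact norm_pow_sq_add_le hq m _
  have h2 : ∀ N : ℕ, ∑' m : ℕ, q ^ (m ^ 2 + a * m) * invPoch q ((N : ℤ) - m) * baileyKer q a m s =
      q ^ (s ^ 2 + a * s) * baileyKer q a N s := fun N => by
    rw [← sum_baileyKer hq N a hs]
    refine tsum_eq_sum fun m hm => ?_
    have : N < m := by simpa [Nat.lt_succ_iff] using hm
    rw [invPoch_of_neg q (by lia)]; simp
  simp_rw [h2] at h1
  have h3 : Tendsto (fun N : ℕ => q ^ (s ^ 2 + a * s) * baileyKer q a N s) atTop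
      (𝓝 (q ^ (s ^ 2 + a * s) * ((qPochInf q q)⁻¹ * (qPochInf q q)⁻¹))) := by
    refine ((hlim s).mul ?_).const_mul _
    simpa [add_assoc] using tendsto_invPoch_add hq (s + a)
  have h4 := tendsto_nhds_unique h1 h3
  have h5 : ∑' m : ℕ, q ^ (m ^ 2 + a * m) * (qPochInf q q)⁻¹ * baileyKer q a m s =
      (qPochInf q q)⁻¹ * ∑' m : ℕ, q ^ (m ^ 2 + a * m) * baileyKer q a m s := by
    rw [← tsum_mul_left]
    exact tsum_congr fun m => by ring
  rw [h5] at h4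
  apply mul_left_cancel₀ (inv_ne_zero hne)
  rw [h4]; ring

lemma summable_pow_mul_baileySum {q : ℂ} (hq : ‖q‖ < 1) (a : ℕ) (d : ℤ) {x : ℤ → ℂ}
    (hx : Summable x) :
    Summable fun p : ℕ × ℤ => q ^ (p.1 ^ 2 + a * p.1) * (x p.2 * baileyKer q a p.1 (d * p.2)) := by
  obtain ⟨M, hM, hMb⟩ := exists_norm_baileyKer_le hq
  have h : Summable fun p : ℕ × ℤ => ‖q‖ ^ p.1 * ‖x p.2‖ :=
    Summable.mul_of_nonneg (f := fun n : ℕ => ‖q‖ ^ n) (g := fun r => ‖x r‖)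
      (summable_geometric_of_lt_one (norm_nonneg q) hq) hx.norm
      (by intro n; simp only [Pi.zero_apply]; positivity)
      (by intro n; simp only [Pi.zero_apply]; positivity)
  refine Summable.of_norm_bounded (h.mul_right M) fun p => ?_
  rw [norm_mul, norm_mul, mul_assoc]
  have := hMb a p.1 (d * p.2)
  gcongr
  exact norm_pow_sq_add_le hq _ _

lemma tsum_baileySum {q : ℂ} (hq : ‖q‖ < 1) (a : ℕ) {d : ℤ}
    (hs : ∀ r, 0 ≤ d * r ∨ d * r ≤ -a) {x : ℤ → ℂ} (hx : Summable x) :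
    ∑' n : ℕ, q ^ (n ^ 2 + a * n) * baileySum q a d x n =
      (qPochInf q q)⁻¹ * ∑' r, x r * q ^ ((d * r) ^ 2 + a * (d * r)) := by
  unfold baileySum
  simp_rw [← tsum_mul_left]
  rw [Summable.tsum_comm (f := fun (r : ℤ) (n : ℕ) =>
    q ^ (n ^ 2 + a * n) * (x r * baileyKer q a n (d * r)))
    ((Equiv.prodComm ℤ ℕ).summable_iff.mpr (summable_pow_mul_baileySum hq a d hx))]
  refine tsum_congr fun r => ?_
  rw [mul_left_comm, ← tsum_baileyKer hq a (hs r), ← tsum_mul_left]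
  exact tsum_congr fun n => by ring

lemma tendsto_baileySum {q : ℂ} (hq : ‖q‖ < 1) (a d : ℤ) {x : ℤ → ℂ} (hx : Summable x) :
    Tendsto (fun n : ℕ => baileySum q a d x n) atTop
      (𝓝 ((∑' r, x r) * ((qPochInf q q)⁻¹ * (qPochInf q q)⁻¹))) := by
  obtain ⟨M, hM, hMb⟩ := exists_norm_baileyKer_le hq
  rw [← tsum_mul_right]
  refine tendsto_tsum_of_dominated_convergence (bound := fun r => ‖x r‖ * M)
    (hx.norm.mul_right _) (fun r => ?_) (Eventually.of_forall fun n r => ?_)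
  · refine Tendsto.const_mul _ (Tendsto.mul ?_ ?_)
    · simpa [sub_eq_add_neg] using tendsto_invPoch_add hq (-(d * r))
    · simpa [add_assoc] using tendsto_invPoch_add hq (d * r + a)
  · rw [norm_mul]
    have := hMb a n (d * r)
    gcongr

lemma tsum_prod_eq_tsum_sum_range {f : ℕ × ℕ → ℂ} (hf : Summable f) :
    ∑' p, f p = ∑' n : ℕ, ∑ k ∈ Finset.range (n + 1), f (n - k, k) := by
  rw [← Finset.HasAntidiagonal.sigmaAntidiagonalEquivProd.tsum_eq f]
  refine (Summable.tsum_sigma' (fun n => (hasSum_fintype _).summable)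
      (Finset.HasAntidiagonal.sigmaAntidiagonalEquivProd.summable_iff.mpr hf)).trans ?_
  refine tsum_congr fun n => ?_
  rw [tsum_fintype, ← Finset.Nat.sum_antidiagonal_eq_sum_range_succ_mk
    (fun p => f (p.2, p.1)), ← Finset.Nat.sum_antidiagonal_swap]
  exact Finset.sum_coe_sort (Finset.HasAntidiagonal.antidiagonal n) f

/-- Summation of the generating terms of a two-fold Bailey chain along `n = j + k`. -/
lemma tsum_prod_invPoch {q : ℂ} (w γ : ℕ → ℂ)
    (hf : Summable fun p : ℕ × ℕ => w (p.1 + p.2) * (invPoch q p.1 * γ p.2)) :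
    ∑' p : ℕ × ℕ, w (p.1 + p.2) * (invPoch q p.1 * γ p.2) =
      ∑' n : ℕ, w n * ∑ k ∈ Finset.range (n + 1), invPoch q ((n : ℤ) - k) * γ k := by
  rw [tsum_prod_eq_tsum_sum_range hf]
  refine tsum_congr fun n => ?_
  rw [Finset.mul_sum]
  refine Finset.sum_congr rfl fun k hk => ?_
  have : k ≤ n := by simpa [Nat.lt_succ_iff] using hk
  simp only
  rw [Nat.sub_add_cancel this, Nat.cast_sub this]

end MizunoNahm
-- Theta terms and Slater's Bailey pairs of types G and C
namespace MizunoNahm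
open Filter Topology

/-- The general term `(-1)^r h^(A r² + B r)` of a theta series. -/
noncomputable def thetaTerm (h : ℂ) (A B r : ℤ) : ℂ := (-1) ^ r * h ^ (A * r ^ 2 + B * r)

lemma pow_zpow' (h : ℂ) (k : ℕ) (s : ℤ) : (h ^ k) ^ s = h ^ (k * s) := by
  rw [← zpow_natCast, ← zpow_mul]

lemma neg_one_zpow_neg (r : ℤ) : (-1 : ℂ) ^ (-r) = (-1) ^ r := by
  rw [zpow_neg, ← inv_zpow]; norm_num

lemma thetaTerm_mul_zpow {h : ℂ} (h0 : h ≠ 0) {A B A' B' r e : ℤ}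
    (he : A' * r ^ 2 + B' * r = A * r ^ 2 + B * r + e) :
    thetaTerm h A B r * h ^ e = thetaTerm h A' B' r := by
  unfold thetaTerm
  rw [he, zpow_add₀ h0 _ e, mul_assoc]

lemma thetaTerm_sub {h : ℂ} (h0 : h ≠ 0) (A B c r : ℤ) :
    thetaTerm h A B (c - r) =
      (-1) ^ c * h ^ (A * c ^ 2 - 2 * A * c * r + B * c - 2 * B * r) * thetaTerm h A B r := by
  unfold thetaTerm
  rw [sub_eq_add_neg c r, zpow_add₀ (by norm_num), neg_one_zpow_neg,
    show A * (c + -r) ^ 2 + B * (c + -r) =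
      (A * c ^ 2 - 2 * A * c * r + B * c - 2 * B * r) + (A * r ^ 2 + B * r) by ring, zpow_add₀ h0]
  ring

lemma thetaTerm_add_one {h : ℂ} (h0 : h ≠ 0) (A B r : ℤ) :
    thetaTerm h A B (r + 1) = -(h ^ (A + B + 2 * A * r) * thetaTerm h A B r) := by
  unfold thetaTerm
  rw [zpow_add₀ (by norm_num), show A * (r + 1) ^ 2 + B * (r + 1) =
      (A + B + 2 * A * r) + (A * r ^ 2 + B * r) by ring, zpow_add₀ h0]
  ring

lemma thetaTerm_neg (h : ℂ) (A B r : ℤ) : thetaTerm h A B (-r) = thetaTerm h A (-B) r := by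
  unfold thetaTerm
  rw [neg_one_zpow_neg]
  congr 2; ring

lemma summable_thetaTerm {h : ℂ} (h0 : h ≠ 0) (h1 : ‖h‖ < 1) {A B : ℤ} (hAB : |B| < A) :
    Summable (thetaTerm h A B) := by
  have hb : ∀ r : ℤ, ‖thetaTerm h A B r‖ ≤ ‖h‖ ^ r.natAbs := fun r => by
    unfold thetaTerm
    rw [norm_mul, norm_zpow, norm_neg, norm_one, one_zpow, one_mul, norm_zpow, ← zpow_natCast]
    refine zpow_le_zpow_right_of_le_one₀ (norm_pos_iff.mpr h0) h1.le ?_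
    rw [Int.natCast_natAbs, ← sq_abs r]
    have h2 : -(|B| * |r|) ≤ B * r := by rw [← abs_mul]; exact neg_abs_le _
    have h3 : |r| ≤ |r| ^ 2 := by
      rcases eq_or_ne r 0 with rfl | hr
      · simp
      · have := Int.one_le_abs hr; nlinarith
    nlinarith [abs_nonneg r, abs_nonneg B]
  have hg := summable_geometric_of_lt_one (norm_nonneg h) h1
  refine Summable.of_norm_bounded (Summable.of_nat_of_neg ?_ ?_) hb <;> simpa using hg

section ClassG

variable {h : ℂ}

/-! The Bailey pair with `α_r = (-1)^r q^((3 r² + r) / 4)`, where `q = h⁴`. -/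

/-- With `x = h^(4k+2)` and `y = h^(4r+2)`, the lowering factor is `1 - xy = (1 + x) - x(1 + y)`;
the theta term times `1 + y` is antisymmetric under `r ↦ -1 - r`. -/
lemma baileySum_zero_eq_mul_one (h0 : h ≠ 0) (h1 : ‖h‖ < 1) (k : ℕ) :
    baileySum (h ^ 4) 0 1 (thetaTerm h 3 1) k =
      (1 + h ^ (4 * k + 2)) * baileySum (h ^ 4) 1 1 (thetaTerm h 3 1) k := by
  have hq : ‖h ^ 4‖ < 1 := by rw [norm_pow]; exact pow_lt_one₀ (norm_nonneg _) h1 (by norm_num)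
  have hz : ∑' r, thetaTerm h 3 1 r * (1 + h ^ (4 * r + 2)) * baileyKer (h ^ 4) 1 k (1 * r) = 0 := by
    refine tsum_eq_zero_of_reflect (-1) fun r => ?_
    rw [show (1 : ℤ) * (-1 - r) = -1 - 1 * r by ring, baileyKer_reflect, thetaTerm_sub h0]
    have e1 : h ^ (3 * (-1 : ℤ) ^ 2 - 2 * 3 * -1 * r + 1 * -1 - 2 * 1 * r) = h ^ (4 * r + 2) := by
      congr 1; ring
    have e2 : h ^ (4 * r + 2) * h ^ (4 * (-1 - r) + 2) = 1 := by
      rw [← zpow_add₀ h0, show 4 * r + 2 + (4 * (-1 - r) + 2) = 0 by ring, zpow_zero]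
    rw [e1]
    rw [show ((-1 : ℂ) ^ (-1 : ℤ)) = -1 by norm_num]
    linear_combination (-(thetaTerm h 3 1 r * baileyKer (h ^ 4) 1 k (1 * r))) * e2
  have e : ∀ r, thetaTerm h 3 1 r * baileyKer (h ^ 4) 0 k (1 * r) =
      (1 + h ^ (4 * k + 2)) * (thetaTerm h 3 1 r * baileyKer (h ^ 4) 1 k (1 * r)) -
      h ^ (4 * k + 2) *
        (thetaTerm h 3 1 r * (1 + h ^ (4 * r + 2)) * baileyKer (h ^ 4) 1 k (1 * r)) := fun r => by
    have h2 := baileyKer_lower hq 0 k (1 * r)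
    rw [zero_add] at h2
    rw [← h2, pow_zpow']
    have e2 : h ^ (((4 : ℕ) : ℤ) * (k + 1 * r + 1)) = h ^ (4 * k + 2) * h ^ (4 * r + 2) := by
      rw [← zpow_natCast, ← zpow_add₀ h0]; congr 1; push_cast; ring
    rw [e2]; ring
  unfold baileySum
  rw [tsum_congr e, Summable.tsum_sub, tsum_mul_left, tsum_mul_left, hz, mul_zero, sub_zero]
  · exact (summable_mul_baileyKer _ _ _ one_ne_zero _).mul_left _
  · exact (summable_mul_baileyKer (h ^ 4) 1 k one_ne_zero
      fun r => thetaTerm h 3 1 r * (1 + h ^ (4 * r + 2))).mul_left _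

/-- Uses `1 - q^(k+1-r) = (1 - q^(2k+2)) - q^(k+1-r) (1 - q^(k+1+r))`. The last bracket lowers `a`
to `-1`, where the kernel is symmetric under `r ↦ 1 - r` and the coefficient is antisymmetric. -/
lemma baileySum_one_eq_mul_succ (h0 : h ≠ 0) (h1 : ‖h‖ < 1) (k : ℕ) :
    baileySum (h ^ 4) 1 1 (thetaTerm h 3 1) k =
      (1 - (h ^ 4) ^ (2 * k + 2)) * baileySum (h ^ 4) 0 1 (thetaTerm h 3 1) ((k + 1 : ℕ) : ℤ) := by
  have hq : ‖h ^ 4‖ < 1 := by rw [norm_pow]; exact pow_lt_one₀ (norm_nonneg _) h1 (by norm_num)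
  have hz : ∑' r, thetaTerm h 3 1 r * (h ^ 4) ^ (-r) *
      baileyKer (h ^ 4) (-1) ((k + 1 : ℕ) : ℤ) (1 * r) = 0 := by
    refine tsum_eq_zero_of_reflect 1 fun r => ?_
    rw [show (1 : ℤ) * (1 - r) = -(-1) - 1 * r by ring, baileyKer_reflect, thetaTerm_sub h0,
      pow_zpow', pow_zpow']
    have e2 : h ^ (3 * (1 : ℤ) ^ 2 - 2 * 3 * 1 * r + 1 * 1 - 2 * 1 * r) *
        h ^ (((4 : ℕ) : ℤ) * (-(1 - r))) = h ^ (((4 : ℕ) : ℤ) * (-r)) := by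
      rw [← zpow_add₀ h0]; congr 1; push_cast; ring
    rw [← e2, zpow_one]
    ring
  have e : ∀ r, thetaTerm h 3 1 r * baileyKer (h ^ 4) 1 k (1 * r) =
      (1 - (h ^ 4) ^ (2 * k + 2)) *
        (thetaTerm h 3 1 r * baileyKer (h ^ 4) 0 ((k + 1 : ℕ) : ℤ) (1 * r)) -
      (h ^ 4) ^ (k + 1) * (thetaTerm h 3 1 r * (h ^ 4) ^ (-r) *
        baileyKer (h ^ 4) (-1) ((k + 1 : ℕ) : ℤ) (1 * r)) := fun r => by
    have h2 := baileyKer_lower hq (-1) ((k + 1 : ℕ) : ℤ) (1 * r)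
    have h3 := baileyKer_pred hq 0 ((k + 1 : ℕ) : ℤ) (1 * r)
    rw [show (-1 : ℤ) + 1 = 0 by ring] at h2
    rw [zero_add, show ((k + 1 : ℕ) : ℤ) - 1 = k by simp] at h3
    rw [← h2, ← h3]
    have hh : h ^ 4 ≠ 0 := pow_ne_zero _ h0
    rw [show ((k + 1 : ℕ) : ℤ) - 1 * r = ((k + 1 : ℕ) : ℤ) + (-r) by ring,
      show ((k + 1 : ℕ) : ℤ) + 1 * r + 0 = ((k + 1 : ℕ) : ℤ) + r by ring, zpow_add₀ hh,
      zpow_add₀ hh, zpow_natCast]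
    have e3 : (h ^ 4) ^ (-r) * (h ^ 4) ^ r = 1 := by
      rw [← zpow_add₀ hh, neg_add_cancel, zpow_zero]
    have e4 : (h ^ 4) ^ (2 * k + 2) = (h ^ 4) ^ (k + 1) * (h ^ 4) ^ (k + 1) := by
      rw [← pow_add]; congr 1; ring
    rw [e4]
    linear_combination (-(thetaTerm h 3 1 r * baileyKer (h ^ 4) 0 ((k + 1 : ℕ) : ℤ) (1 * r) *
      (h ^ 4) ^ (k + 1) * (h ^ 4) ^ (k + 1))) * e3
  unfold baileySum
  rw [tsum_congr e, Summable.tsum_sub, tsum_mul_left, tsum_mul_left, hz, mul_zero, sub_zero]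
  · exact (summable_mul_baileyKer _ _ _ one_ne_zero _).mul_left _
  · exact (summable_mul_baileyKer (h ^ 4) (-1) ((k + 1 : ℕ) : ℤ) one_ne_zero
      fun r => thetaTerm h 3 1 r * (h ^ 4) ^ (-r)).mul_left _

lemma baileySum_at_zero (q : ℂ) {d : ℤ} (hd : d ≠ 0) (x : ℤ → ℂ) : baileySum q 0 d x 0 = x 0 := by
  unfold baileySum
  rw [tsum_eq_single 0]
  · simp [baileyKer]
  · intro r hr
    have : d * r ≠ 0 := mul_ne_zero hd hr
    rw [baileyKer_eq_zero, mul_zero]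
    lia

/-- Slater's Bailey pairs of type G relative to `a = 1` and `a = q`. -/
lemma inv_eq_baileySum_G (h0 : h ≠ 0) (h1 : ‖h‖ < 1) (k : ℕ) :
    (qPoch ((h ^ 4) ^ 2) ((h ^ 4) ^ 2) k * qPoch (-h ^ 2) (h ^ 4) k)⁻¹ =
        baileySum (h ^ 4) 0 1 (thetaTerm h 3 1) k ∧
      (qPoch ((h ^ 4) ^ 2) ((h ^ 4) ^ 2) k * qPoch (-h ^ 2) (h ^ 4) (k + 1))⁻¹ =
        baileySum (h ^ 4) 1 1 (thetaTerm h 3 1) k := by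
  have hq : ‖h ^ 4‖ < 1 := by rw [norm_pow]; exact pow_lt_one₀ (norm_nonneg _) h1 (by norm_num)
  have hq2 : ‖(h ^ 4) ^ 2‖ < 1 := by
    rw [norm_pow]; exact pow_lt_one₀ (norm_nonneg _) hq (by norm_num)
  have hp : ‖-h ^ 2‖ < 1 := by
    rw [norm_neg, norm_pow]; exact pow_lt_one₀ (norm_nonneg _) h1 (by norm_num)
  -- The two families climb in a zigzag: `a = 0` at `k`, then `a = 1` at `k`, then `a = 0` at `k +
  -- 1`, each move supplying one new factor.
  have step : ∀ k : ℕ, (qPoch ((h ^ 4) ^ 2) ((h ^ 4) ^ 2) k * qPoch (-h ^ 2) (h ^ 4) k)⁻¹ =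
        baileySum (h ^ 4) 0 1 (thetaTerm h 3 1) k →
      (qPoch ((h ^ 4) ^ 2) ((h ^ 4) ^ 2) k * qPoch (-h ^ 2) (h ^ 4) (k + 1))⁻¹ =
        baileySum (h ^ 4) 1 1 (thetaTerm h 3 1) k := fun k hk => by
    rw [baileySum_zero_eq_mul_one h0 h1] at hk
    have hne := one_sub_mul_pow_ne_zero hp hq k
    rw [qPoch_succ, ← mul_assoc, mul_inv, hk]
    have : 1 + h ^ (4 * k + 2) = 1 - -h ^ 2 * (h ^ 4) ^ k := by ring
    rw [this, mul_right_comm, mul_inv_cancel₀ hne, one_mul]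
  induction k with
  | zero =>
    refine ⟨?_, step 0 ?_⟩ <;> simp [baileySum_at_zero, thetaTerm]
  | succ k ih =>
    have hs : (qPoch ((h ^ 4) ^ 2) ((h ^ 4) ^ 2) (k + 1) * qPoch (-h ^ 2) (h ^ 4) (k + 1))⁻¹ =
        baileySum (h ^ 4) 0 1 (thetaTerm h 3 1) ((k + 1 : ℕ) : ℤ) := by
      have h2 := ih.2
      rw [baileySum_one_eq_mul_succ h0 h1] at h2
      have hne := one_sub_mul_pow_ne_zero hq2 hq2 k
      rw [qPoch_succ ((h ^ 4) ^ 2), mul_right_comm, mul_inv, h2]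
      have : 1 - (h ^ 4) ^ (2 * k + 2) = 1 - (h ^ 4) ^ 2 * ((h ^ 4) ^ 2) ^ k := by ring
      rw [this, mul_right_comm, mul_inv_cancel₀ hne, one_mul]
    exact ⟨hs, step _ hs⟩

end ClassG

section ClassC

variable {q : ℂ}

/-! The Bailey pair with `α_{2 l} = (-1)^l q^(3 l² + l)` and `α_r = 0` for odd `r`. -/

/-- Uses `1 - q^(m+2l+1) = (1 - q^(2m+1)) - q^(m+2l+1) (1 - q^(m-2l))`; the last part cancels under
`l ↦ -1 - l`. -/
lemma baileySum_zero_eq_mul_one_even (h0 : q ≠ 0) (hq : ‖q‖ < 1) (m : ℕ) :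
    baileySum q 0 2 (thetaTerm q 3 1) m =
      (1 - q ^ (2 * m + 1)) * baileySum q 1 2 (thetaTerm q 3 1) m := by
  have hz : ∑' l, thetaTerm q 3 1 l * q ^ (2 * l) * baileyKer q 2 ((m : ℤ) - 1) (2 * l) = 0 := by
    refine tsum_eq_zero_of_reflect (-1) fun l => ?_
    rw [show (2 : ℤ) * (-1 - l) = -2 - 2 * l by ring, baileyKer_reflect, thetaTerm_sub h0]
    have e2 : q ^ (3 * (-1 : ℤ) ^ 2 - 2 * 3 * -1 * l + 1 * -1 - 2 * 1 * l) *
        q ^ (-2 - 2 * l) = q ^ (2 * l) := by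
      rw [← zpow_add₀ h0]; congr 1; ring
    rw [← e2, show ((-1 : ℂ) ^ (-1 : ℤ)) = -1 by norm_num]
    ring
  have e : ∀ l, thetaTerm q 3 1 l * baileyKer q 0 m (2 * l) =
      (1 - q ^ (2 * m + 1)) * (thetaTerm q 3 1 l * baileyKer q 1 m (2 * l)) -
      q ^ (m + 1) *
        (thetaTerm q 3 1 l * q ^ (2 * l) * baileyKer q 2 ((m : ℤ) - 1) (2 * l)) := fun l => by
    have h2 := baileyKer_lower hq 0 m (2 * l)
    have h3 := baileyKer_pred hq 1 m (2 * l)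
    rw [zero_add] at h2
    rw [show (1 : ℤ) + 1 = 2 by ring] at h3
    rw [← h2, ← h3, show (m : ℤ) + 2 * l + 1 = ((m + 1 : ℕ) : ℤ) + 2 * l by push_cast; ring,
      zpow_add₀ h0, zpow_natCast, zpow_sub₀ h0, zpow_natCast]
    have := zpow_ne_zero (2 * l) h0
    field_simp
    ring
  unfold baileySum
  rw [tsum_congr e, Summable.tsum_sub, tsum_mul_left, tsum_mul_left, hz, mul_zero, sub_zero]
  · exact (summable_mul_baileyKer _ _ _ two_ne_zero _).mul_left _
  · exact (summable_mul_baileyKer q 2 ((m : ℤ) - 1) two_ne_zero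
      fun l => thetaTerm q 3 1 l * q ^ (2 * l)).mul_left _

/-- Uses `1 - q^(m+1-2l) = (1 - q^(m+1)) - q^(m+1) (q^(-2l) - 1)`; the last part cancels under `l ↦
-l`. -/
lemma baileySum_one_eq_mul_succ_even (h0 : q ≠ 0) (hq : ‖q‖ < 1) (m : ℕ) :
    baileySum q 1 2 (thetaTerm q 3 1) m =
      (1 - q ^ (m + 1)) * baileySum q 0 2 (thetaTerm q 3 1) ((m + 1 : ℕ) : ℤ) := by
  have hz : ∑' l, thetaTerm q 3 1 l * (q ^ (-(2 * l)) - 1) *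
      baileyKer q 0 ((m + 1 : ℕ) : ℤ) (2 * l) = 0 := by
    refine tsum_eq_zero_of_reflect 0 fun l => ?_
    rw [show (2 : ℤ) * (0 - l) = -0 - 2 * l by ring, baileyKer_reflect, thetaTerm_sub h0]
    have e1 : q ^ (3 * (0 : ℤ) ^ 2 - 2 * 3 * 0 * l + 1 * 0 - 2 * 1 * l) = q ^ (-(2 * l)) := by
      congr 1; ring
    have e2 : q ^ (-(2 * l)) * q ^ (-(-0 - 2 * l)) = 1 := by
      rw [← zpow_add₀ h0, show -(2 * l) + -(-0 - 2 * l) = 0 by ring, zpow_zero]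
    rw [e1, zpow_zero]
    linear_combination (thetaTerm q 3 1 l * baileyKer q 0 ((m + 1 : ℕ) : ℤ) (2 * l)) * e2
  have e : ∀ l, thetaTerm q 3 1 l * baileyKer q 1 m (2 * l) =
      (1 - q ^ (m + 1)) * (thetaTerm q 3 1 l * baileyKer q 0 ((m + 1 : ℕ) : ℤ) (2 * l)) -
      q ^ (m + 1) * (thetaTerm q 3 1 l * (q ^ (-(2 * l)) - 1) *
        baileyKer q 0 ((m + 1 : ℕ) : ℤ) (2 * l)) := fun l => by
    have h3 := baileyKer_pred hq 0 ((m + 1 : ℕ) : ℤ) (2 * l)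
    rw [zero_add, show ((m + 1 : ℕ) : ℤ) - 1 = m by simp] at h3
    rw [← h3, sub_eq_add_neg ((m + 1 : ℕ) : ℤ), zpow_add₀ h0, zpow_natCast]
    ring
  unfold baileySum
  rw [tsum_congr e, Summable.tsum_sub, tsum_mul_left, tsum_mul_left, hz, mul_zero, sub_zero]
  · exact (summable_mul_baileyKer _ _ _ two_ne_zero _).mul_left _
  · exact (summable_mul_baileyKer q 0 ((m + 1 : ℕ) : ℤ) two_ne_zero
      fun l => thetaTerm q 3 1 l * (q ^ (-(2 * l)) - 1)).mul_left _

/-- Slater's Bailey pairs of type C relative to `a = 1` and `a = q`. -/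
lemma inv_eq_baileySum_C (h0 : q ≠ 0) (hq : ‖q‖ < 1) (m : ℕ) :
    (qPoch q q m * qPoch q (q ^ 2) m)⁻¹ = baileySum q 0 2 (thetaTerm q 3 1) m ∧
      (qPoch q q m * qPoch q (q ^ 2) (m + 1))⁻¹ = baileySum q 1 2 (thetaTerm q 3 1) m := by
  have hq2 : ‖q ^ 2‖ < 1 := by rw [norm_pow]; exact pow_lt_one₀ (norm_nonneg _) hq (by norm_num)
  have step : ∀ m : ℕ, (qPoch q q m * qPoch q (q ^ 2) m)⁻¹ =
        baileySum q 0 2 (thetaTerm q 3 1) m →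
      (qPoch q q m * qPoch q (q ^ 2) (m + 1))⁻¹ =
        baileySum q 1 2 (thetaTerm q 3 1) m := fun m hm => by
    rw [baileySum_zero_eq_mul_one_even h0 hq] at hm
    have hne := one_sub_mul_pow_ne_zero hq hq2 m
    rw [qPoch_succ, ← mul_assoc, mul_inv, hm]
    have : 1 - q ^ (2 * m + 1) = 1 - q * (q ^ 2) ^ m := by ring
    rw [this]
    field_simp
  induction m with
  | zero => refine ⟨?_, step 0 ?_⟩ <;> simp [baileySum_at_zero, thetaTerm]
  | succ m ih =>
    have hs : (qPoch q q (m + 1) * qPoch q (q ^ 2) (m + 1))⁻¹ =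
        baileySum q 0 2 (thetaTerm q 3 1) ((m + 1 : ℕ) : ℤ) := by
      have h2 := ih.2
      rw [baileySum_one_eq_mul_succ_even h0 hq] at h2
      have hne := one_sub_mul_pow_ne_zero hq hq m
      rw [qPoch_succ q q, mul_right_comm, mul_inv, h2, pow_succ']
      field_simp
    exact ⟨hs, step _ hs⟩

end ClassC

end MizunoNahm
-- Euler's series and a finite Jacobi triple product
namespace MizunoNahm
open Filter Topology

variable {p : ℂ}

lemma norm_pow_lt_one (h1 : ‖p‖ < 1) {k : ℕ} (hk : k ≠ 0) : ‖p ^ k‖ < 1 := by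
  rw [norm_pow]; exact pow_lt_one₀ (norm_nonneg _) h1 hk

lemma norm_neg_lt_one (h1 : ‖p‖ < 1) : ‖-p‖ < 1 := by rwa [norm_neg]

/-- Euler's series `∑_i p^(i² + 2 i k) / (p²; p²)_i`. -/
noncomputable def eulerSum (p : ℂ) (k : ℕ) : ℂ :=
  ∑' i : ℕ, p ^ (i ^ 2 + 2 * i * k) * invPoch (p ^ 2) i

lemma exists_norm_eulerSum_term_le (h1 : ‖p‖ < 1) :
    ∃ M : ℝ, ∀ k i : ℕ, ‖p ^ (i ^ 2 + 2 * i * k) * invPoch (p ^ 2) i‖ ≤ ‖p‖ ^ i * M := by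
  obtain ⟨M, hM, hMb⟩ := exists_norm_invPoch_le (norm_pow_lt_one h1 two_ne_zero)
  refine ⟨M, fun k i => ?_⟩
  rw [norm_mul]
  have := hMb i
  gcongr
  exact norm_pow_sq_add_le h1 i _

lemma summable_eulerSum (h1 : ‖p‖ < 1) (k : ℕ) :
    Summable fun i : ℕ => p ^ (i ^ 2 + 2 * i * k) * invPoch (p ^ 2) i := by
  obtain ⟨M, hM⟩ := exists_norm_eulerSum_term_le h1
  exact Summable.of_norm_bounded
    ((summable_geometric_of_lt_one (norm_nonneg p) h1).mul_right M) (hM k)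

/-- In the difference of consecutive sums the factor `1 - p^(2i)` lowers the reciprocal factorial,
and the shift `i ↦ i + 1` returns the same series. -/
lemma eulerSum_eq_mul_succ (h1 : ‖p‖ < 1) (k : ℕ) :
    eulerSum p k = (1 - -p * (p ^ 2) ^ k) * eulerSum p (k + 1) := by
  have hd : eulerSum p k - eulerSum p (k + 1) = p ^ (2 * k + 1) * eulerSum p (k + 1) := by
    unfold eulerSum
    rw [← (summable_eulerSum h1 k).tsum_sub (summable_eulerSum h1 (k + 1))]
    have e : ∀ i : ℕ, p ^ (i ^ 2 + 2 * i * k) * invPoch (p ^ 2) i -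
        p ^ (i ^ 2 + 2 * i * (k + 1)) * invPoch (p ^ 2) i =
        p ^ (i ^ 2 + 2 * i * k) * invPoch (p ^ 2) ((i : ℤ) - 1) := fun i => by
      rw [← one_sub_zpow_mul_invPoch (norm_pow_lt_one h1 two_ne_zero), zpow_natCast]
      ring
    rw [tsum_congr e, Summable.tsum_eq_zero_add, ← tsum_mul_left]
    · rw [invPoch_of_neg _ (show ((0 : ℕ) : ℤ) - 1 < 0 by simp), mul_zero, zero_add]
      refine tsum_congr fun i => ?_
      rw [show ((i + 1 : ℕ) : ℤ) - 1 = i by simp]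
      ring
    · exact ((summable_eulerSum h1 k).sub (summable_eulerSum h1 (k + 1))).congr e
  linear_combination hd

lemma eulerSum_zero (h1 : ‖p‖ < 1) (k : ℕ) :
    eulerSum p 0 = qPoch (-p) (p ^ 2) k * eulerSum p k := by
  induction k with
  | zero => simp
  | succ k ih => rw [ih, eulerSum_eq_mul_succ h1 k, qPoch_succ, mul_assoc]

lemma tendsto_eulerSum (h1 : ‖p‖ < 1) : Tendsto (eulerSum p) atTop (𝓝 1) := by
  obtain ⟨M, hM⟩ := exists_norm_eulerSum_term_le h1
  have h : Tendsto (eulerSum p) atTop (𝓝 (∑' i : ℕ, if i = 0 then (1 : ℂ) else 0)) := by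
    refine tendsto_tsum_of_dominated_convergence
      ((summable_geometric_of_lt_one (norm_nonneg p) h1).mul_right M) (fun i => ?_)
      (Eventually.of_forall fun k i => hM k i)
    rcases eq_or_ne i 0 with rfl | hi
    · simp
    · simp only [hi, if_false]
      have := (tendsto_pow_atTop_nhds_zero_of_norm_lt_one
        (norm_pow_lt_one h1 (k := 2 * i) (by simpa using hi))).const_mul (p ^ i ^ 2)
      have := this.mul_const (invPoch (p ^ 2) i)
      simpa [pow_add, pow_mul] using this
  simpa using h

lemma eulerSum_zero_eq (h1 : ‖p‖ < 1) : eulerSum p 0 = qPochInf (-p) (p ^ 2) := by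
  have h := (tendsto_qPoch (-p) (norm_pow_lt_one h1 two_ne_zero)).mul (tendsto_eulerSum h1)
  simp_rw [← eulerSum_zero h1, mul_one] at h
  exact tendsto_nhds_unique tendsto_const_nhds h

/-- Iterating the recurrence from `0`, to `k` and to infinity, sums the free index of a Nahm sum in
closed form. -/
lemma eulerSum_eq (h1 : ‖p‖ < 1) (k : ℕ) :
    eulerSum p k = qPochInf (-p) (p ^ 2) * (qPoch (-p) (p ^ 2) k)⁻¹ := by
  have := qPoch_ne_zero (norm_neg_lt_one h1) (norm_pow_lt_one h1 two_ne_zero) k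
  rw [← eulerSum_zero_eq h1, eulerSum_zero h1 k]
  field_simp

/-- With `B = p⁴`, write `1 - B^(2n+1) = (1 - B^(n+r+1)) + B^(n+r+1) (1 - B^(n-r))`. The second part
is, up to the sign and power absorbed by the theta term, the first with `r` shifted by one.
`tripleProduct_even` is the companion half-step. -/
lemma tripleProduct_odd (h0 : p ≠ 0) (h1 : ‖p‖ < 1) (n : ℕ) :
    (1 - (p ^ 4) ^ (2 * n + 1)) * baileySum (p ^ 4) 1 1 (thetaTerm p 2 1) n =
      (1 - p ^ (4 * n + 1)) * baileySum (p ^ 4) 0 1 (thetaTerm p 2 1) n := by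
  have hB := norm_pow_lt_one h1 four_ne_zero
  have hB0 : p ^ 4 ≠ 0 := pow_ne_zero _ h0
  have e : ∀ r, (1 - (p ^ 4) ^ (2 * n + 1)) *
      (thetaTerm p 2 1 r * baileyKer (p ^ 4) 1 n (1 * r)) =
      thetaTerm p 2 1 r * baileyKer (p ^ 4) 0 n (1 * r) -
      p ^ (4 * n + 1) *
        (thetaTerm p 2 1 (r + 1) * baileyKer (p ^ 4) 0 n (1 * (r + 1))) := fun r => by
    have h2 := baileyKer_lower hB 0 n (1 * r)
    have h3 := baileyKer_pred hB 1 n (1 * r)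
    have h4 : baileyKer (p ^ 4) (1 + 1) ((n : ℤ) - 1) (1 * r) =
        baileyKer (p ^ 4) 0 n (1 * (r + 1)) := by
      unfold baileyKer; congr 2 <;> ring
    rw [zero_add] at h2
    rw [← h4, ← h2, ← h3, thetaTerm_add_one h0, pow_zpow', pow_zpow']
    have e1 : p ^ (((4 : ℕ) : ℤ) * ((n : ℤ) + 1 * r + 1)) =
        p ^ (4 * n + 1) * p ^ (2 + 1 + 2 * 2 * r) := by
      rw [← zpow_natCast, ← zpow_add₀ h0]; congr 1; push_cast; ring
    have e2 : (p ^ 4) ^ (2 * n + 1) = p ^ (4 * n + 1) * p ^ (2 + 1 + 2 * 2 * r) *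
        p ^ (((4 : ℕ) : ℤ) * ((n : ℤ) - 1 * r)) := by
      rw [← pow_mul, ← zpow_natCast, ← zpow_natCast, ← zpow_add₀ h0, ← zpow_add₀ h0]
      congr 1; push_cast; ring
    rw [e1, e2]
    ring
  have hS := summable_mul_baileyKer (p ^ 4) 0 n one_ne_zero (thetaTerm p 2 1)
  have hshift := (Equiv.addRight (1 : ℤ)).tsum_eq
    fun r => thetaTerm p 2 1 r * baileyKer (p ^ 4) 0 n (1 * r)
  simp only [Equiv.coe_addRight] at hshift
  unfold baileySum
  rw [← tsum_mul_left, tsum_congr e, hS.tsum_sub, tsum_mul_left, hshift]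
  · ring
  · exact ((Equiv.addRight (1 : ℤ)).summable_iff.mpr hS).mul_left _

lemma tripleProduct_even (h0 : p ≠ 0) (h1 : ‖p‖ < 1) (n : ℕ) :
    (1 - (p ^ 4) ^ (2 * n + 2)) *
        baileySum (p ^ 4) 0 1 (thetaTerm p 2 1) ((n + 1 : ℕ) : ℤ) =
      (1 - p ^ (4 * n + 3)) * baileySum (p ^ 4) 1 1 (thetaTerm p 2 1) n := by
  have hB := norm_pow_lt_one h1 four_ne_zero
  have hB0 : p ^ 4 ≠ 0 := pow_ne_zero _ h0
  have e : ∀ r, (1 - (p ^ 4) ^ (2 * n + 2)) *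
      (thetaTerm p 2 1 r * baileyKer (p ^ 4) 0 ((n + 1 : ℕ) : ℤ) (1 * r)) =
      thetaTerm p 2 1 r * baileyKer (p ^ 4) 1 n (1 * r) -
      p ^ (4 * n + 3) *
        (thetaTerm p 2 1 (r - 1) * baileyKer (p ^ 4) 1 n (1 * (r - 1))) := fun r => by
    have h2 := baileyKer_lower hB (-1) ((n + 1 : ℕ) : ℤ) (1 * r)
    have h3 := baileyKer_pred hB 0 ((n + 1 : ℕ) : ℤ) (1 * r)
    have h4 : baileyKer (p ^ 4) (-1) ((n + 1 : ℕ) : ℤ) (1 * r) =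
        baileyKer (p ^ 4) 1 n (1 * (r - 1)) := by
      unfold baileyKer; congr 2 <;> push_cast <;> ring
    have h5 := thetaTerm_add_one h0 2 1 (r - 1)
    rw [sub_add_cancel] at h5
    rw [show (-1 : ℤ) + 1 = 0 by ring] at h2
    rw [zero_add, show ((n + 1 : ℕ) : ℤ) - 1 = n by simp] at h3
    rw [← h4, ← h2, ← h3, h5, pow_zpow', pow_zpow']
    have e1 : p ^ (((4 : ℕ) : ℤ) * (((n + 1 : ℕ) : ℤ) - 1 * r)) *
        p ^ (2 + 1 + 2 * 2 * (r - 1)) = p ^ (4 * n + 3) := by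
      rw [← zpow_natCast, ← zpow_add₀ h0]; congr 1; push_cast; ring
    have e2 : (p ^ 4) ^ (2 * n + 2) = p ^ (((4 : ℕ) : ℤ) * (((n + 1 : ℕ) : ℤ) - 1 * r)) *
        p ^ (((4 : ℕ) : ℤ) * (((n + 1 : ℕ) : ℤ) + 1 * r + 0)) := by
      rw [← pow_mul, ← zpow_natCast, ← zpow_add₀ h0]
      congr 1; push_cast; ring
    rw [e2, ← e1]
    ring
  have hS := summable_mul_baileyKer (p ^ 4) 1 n one_ne_zero (thetaTerm p 2 1)
  have hshift := (Equiv.subRight (1 : ℤ)).tsum_eq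
    fun r => thetaTerm p 2 1 r * baileyKer (p ^ 4) 1 n (1 * r)
  simp only [Equiv.subRight_apply] at hshift
  unfold baileySum
  rw [← tsum_mul_left, tsum_congr e, hS.tsum_sub, tsum_mul_left, hshift]
  · ring
  · exact ((Equiv.subRight (1 : ℤ)).summable_iff.mpr hS).mul_left _

/-- A finite form of the Jacobi triple product. -/
lemma baileySum_tripleProduct (h0 : p ≠ 0) (h1 : ‖p‖ < 1) (n : ℕ) :
    qPoch (p ^ 4) (p ^ 4) (2 * n) * baileySum (p ^ 4) 0 1 (thetaTerm p 2 1) n =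
      qPoch p (p ^ 2) (2 * n) := by
  induction n with
  | zero => simp [baileySum_at_zero, thetaTerm]
  | succ n ih =>
    have ho := tripleProduct_odd h0 h1 n
    have he := tripleProduct_even h0 h1 n
    rw [show 2 * (n + 1) = 2 * n + 1 + 1 by ring, qPoch_succ, qPoch_succ, qPoch_succ p,
      qPoch_succ p, ← ih]
    have e1 : 1 - p ^ 4 * (p ^ 4) ^ (2 * n) = 1 - (p ^ 4) ^ (2 * n + 1) := by ring
    have e2 : 1 - p ^ 4 * (p ^ 4) ^ (2 * n + 1) = 1 - (p ^ 4) ^ (2 * n + 2) := by ring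
    have e3 : 1 - p * (p ^ 2) ^ (2 * n) = 1 - p ^ (4 * n + 1) := by ring
    have e4 : 1 - p * (p ^ 2) ^ (2 * n + 1) = 1 - p ^ (4 * n + 3) := by ring
    rw [e1, e2, e3, e4]
    linear_combination (qPoch (p ^ 4) (p ^ 4) (2 * n) * (1 - (p ^ 4) ^ (2 * n + 1))) * he +
      (qPoch (p ^ 4) (p ^ 4) (2 * n) * (1 - p ^ (4 * n + 3))) * ho

lemma qPoch_mul_neg (a q : ℂ) (n : ℕ) :
    qPoch a q n * qPoch (-a) q n = qPoch (a ^ 2) (q ^ 2) n := by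
  unfold qPoch
  rw [← Finset.prod_mul_distrib]
  exact Finset.prod_congr rfl fun k _ => by ring

lemma qPoch_odd_mul_even (q : ℂ) (n : ℕ) :
    qPoch q (q ^ 2) n * qPoch (q ^ 2) (q ^ 2) n = qPoch q q (2 * n) := by
  induction n with
  | zero => simp
  | succ n ih =>
    rw [show 2 * (n + 1) = 2 * n + 1 + 1 by ring]
    simp only [qPoch_succ]
    rw [← ih]
    ring

lemma qPoch_even_mul_odd_succ (q : ℂ) (n : ℕ) :
    qPoch q (q ^ 2) (n + 1) * qPoch (q ^ 2) (q ^ 2) n = qPoch q q (2 * n + 1) := by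
  rw [qPoch_succ, qPoch_succ, ← qPoch_odd_mul_even]
  ring

/-- The weight `1 / 2` theta series whose reciprocal is the prefactor of the Nahm sums. -/
lemma qPochInf_mul_tsum_thetaTerm (h0 : p ≠ 0) (h1 : ‖p‖ < 1) :
    qPochInf (-p) (p ^ 2) * (qPochInf (p ^ 2) (p ^ 2))⁻¹ * ∑' r, thetaTerm p 2 1 r = 1 := by
  have hB := norm_pow_lt_one h1 four_ne_zero
  have hq := norm_pow_lt_one h1 two_ne_zero
  have h2n : Tendsto (fun n : ℕ => 2 * n) atTop atTop :=
    tendsto_id.const_mul_atTop' (by norm_num)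
  -- One factor `(p⁴; p⁴)_{2n}` clears the triple product; the other joins `(p; p²)(-p; p²) = (p²;
  -- p⁴)` to form `(p²; p²)_{4n}`. In the limit both cancel against the two inverse products from
  -- `tendsto_baileySum`.
  have hfin : ∀ n : ℕ, qPoch (p ^ 4) (p ^ 4) (2 * n) * qPoch (p ^ 4) (p ^ 4) (2 * n) *
      qPoch (-p) (p ^ 2) (2 * n) * baileySum (p ^ 4) 0 1 (thetaTerm p 2 1) n =
      qPoch (p ^ 2) (p ^ 2) (2 * (2 * n)) := fun n => by
    have ha := baileySum_tripleProduct h0 h1 n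
    have hb := qPoch_mul_neg p (p ^ 2) (2 * n)
    have hc := qPoch_odd_mul_even (p ^ 2) (2 * n)
    rw [show (p ^ 2) ^ 2 = p ^ 4 by ring] at hb hc
    linear_combination (qPoch (p ^ 4) (p ^ 4) (2 * n) * qPoch (-p) (p ^ 2) (2 * n)) * ha +
      qPoch (p ^ 4) (p ^ 4) (2 * n) * hb + hc
  have hl := ((((tendsto_qPoch (p ^ 4) hB).comp h2n).mul ((tendsto_qPoch (p ^ 4) hB).comp h2n)).mul
    ((tendsto_qPoch (-p) hq).comp h2n)).mul
    (tendsto_baileySum hB 0 1 (summable_thetaTerm h0 h1 (A := 2) (B := 1) (by norm_num)))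
  have hr := (tendsto_qPoch (p ^ 2) hq).comp (h2n.comp h2n)
  have h := tendsto_nhds_unique (hl.congr hfin) hr
  have hBne := qPochInf_ne_zero hB hB
  have hqne := qPochInf_ne_zero hq hq
  have h2 : qPochInf (-p) (p ^ 2) * ∑' r, thetaTerm p 2 1 r = qPochInf (p ^ 2) (p ^ 2) := by
    rw [← h]; field_simp
  rw [mul_right_comm, h2, mul_inv_cancel₀ hqne]

end MizunoNahm
-- Two-fold Bailey chains summed to theta series
namespace MizunoNahm
open Filter Topology

/-- One step `∑_{k ≤ n} q^(k² + B k) β_k / (q; q)_{n - k}` of a Bailey chain. -/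
noncomputable def baileyStep (q : ℂ) (B : ℕ) (β : ℕ → ℂ) (n : ℕ) : ℂ :=
  ∑ k ∈ Finset.range (n + 1), invPoch q ((n : ℤ) - k) * (q ^ (k ^ 2 + B * k) * β k)

/-- The two-fold Bailey chain `∑_n q^(n² + A n) ∑_{k ≤ n} q^(k² + B k) β_k / (q; q)_{n - k}`. -/
noncomputable def baileyChain (q : ℂ) (A B : ℕ) (β : ℕ → ℂ) : ℂ :=
  ∑' n : ℕ, q ^ (n ^ 2 + A * n) * baileyStep q B β n

lemma baileyStep_eq {q : ℂ} (hq : ‖q‖ < 1) (a : ℕ) {d : ℤ} (hd : d ≠ 0)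
    (hs : ∀ r, 0 ≤ d * r ∨ d * r ≤ -a) {β : ℕ → ℂ} {x x' : ℤ → ℂ}
    (hβ : ∀ k : ℕ, β k = baileySum q a d x k)
    (hx : ∀ r, x r * q ^ ((d * r) ^ 2 + a * (d * r)) = x' r) (n : ℕ) :
    baileyStep q a β n = baileySum q a d x' n := by
  have h := sum_baileySum hq a hd hs x n
  simp_rw [hx] at h
  rw [← h]
  exact Finset.sum_congr rfl fun k _ => by rw [hβ]; ring

lemma tsum_baileySum' {q : ℂ} (hq : ‖q‖ < 1) (a : ℕ) {d : ℤ}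
    (hs : ∀ r, 0 ≤ d * r ∨ d * r ≤ -a) {x x' : ℤ → ℂ} (hsum : Summable x)
    (hx : ∀ r, x r * q ^ ((d * r) ^ 2 + a * (d * r)) = x' r) :
    ∑' n : ℕ, q ^ (n ^ 2 + a * n) * baileySum q a d x n = (qPochInf q q)⁻¹ * ∑' r, x' r := by
  rw [tsum_baileySum hq a hs hsum]
  simp_rw [hx]

lemma norm_baileySum_le {q : ℂ} (hq : ‖q‖ < 1) (a d : ℤ) {x : ℤ → ℂ} (hx : Summable x) :
    ∃ M : ℝ, ∀ n, ‖baileySum q a d x n‖ ≤ M := by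
  obtain ⟨M, hM, hMb⟩ := exists_norm_baileyKer_le hq
  refine ⟨∑' r, ‖x r‖ * M, fun n => ?_⟩
  refine tsum_of_norm_bounded (hx.norm.mul_right M).hasSum fun r => ?_
  rw [norm_mul]
  have := hMb a n (d * r)
  gcongr

lemma summable_baileyChain {q : ℂ} (hq : ‖q‖ < 1) (A B : ℕ) {β : ℕ → ℂ}
    (hβ : ∃ M : ℝ, ∀ n, ‖β n‖ ≤ M) :
    Summable fun n : ℕ => q ^ (n ^ 2 + A * n) * baileyStep q B β n := by
  obtain ⟨K, hK⟩ := hβ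
  obtain ⟨M, hM, hMb⟩ := exists_norm_invPoch_le hq
  have hK0 : 0 ≤ K := (norm_nonneg _).trans (hK 0)
  have hg := summable_geometric_of_lt_one (norm_nonneg q) hq
  have hb : ∀ n, ‖baileyStep q B β n‖ ≤ M * ((∑' k : ℕ, ‖q‖ ^ k) * K) := fun n => by
    refine (norm_sum_le _ _).trans ?_
    calc ∑ k ∈ Finset.range (n + 1), ‖invPoch q ((n : ℤ) - k) * (q ^ (k ^ 2 + B * k) * β k)‖
        ≤ ∑ k ∈ Finset.range (n + 1), M * (‖q‖ ^ k * K) := by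
          refine Finset.sum_le_sum fun k _ => ?_
          rw [norm_mul, norm_mul]
          have := hMb ((n : ℤ) - k)
          have := hK k
          gcongr
          exact norm_pow_sq_add_le hq k _
      _ ≤ _ := by
          rw [← Finset.mul_sum, ← Finset.sum_mul]
          gcongr
          exact hg.sum_le_tsum _ fun _ _ => by positivity
  refine Summable.of_norm_bounded (hg.mul_right (M * ((∑' k : ℕ, ‖q‖ ^ k) * K))) fun n => ?_
  rw [norm_mul]
  have := hb n
  gcongr
  exact norm_pow_sq_add_le hq n _

lemma one_mul_nonneg_or (r : ℤ) (a : ℕ) (ha : a ≤ 1) : 0 ≤ 1 * r ∨ 1 * r ≤ -(a : ℤ) := by lia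

lemma two_mul_nonneg_or (r : ℤ) (a : ℕ) (ha : a ≤ 2) : 0 ≤ 2 * r ∨ 2 * r ≤ -(a : ℤ) := by lia

section ClassG

variable {h : ℂ}

/-- The bookkeeping of the chain: a step with parameter `a` sends `(A, B)` to `(A + 4, B + 4a)`. -/
lemma thetaTerm_mul_pow_four (h0 : h ≠ 0) (A B A' B' : ℤ) (a : ℕ) (hA : A' = A + 4)
    (hB : B' = B + 4 * a) (r : ℤ) :
    thetaTerm h A B r * (h ^ 4) ^ ((1 * r) ^ 2 + a * (1 * r)) = thetaTerm h A' B' r := by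
  rw [pow_zpow']
  refine thetaTerm_mul_zpow h0 ?_
  subst hA hB; push_cast; ring

/-- The relation `A = B + 4` is exactly antisymmetry about `r ↦ -1 - r` after the twist by `q^r`, so
the chain may switch between `a = 0` and `a = 1` there. -/
lemma baileySum_one_eq_zero (h0 : h ≠ 0) (h1 : ‖h‖ < 1) {A B : ℤ} (hAB : A = B + 4) (n : ℤ) :
    baileySum (h ^ 4) 1 1 (thetaTerm h A B) n = baileySum (h ^ 4) 0 1 (thetaTerm h A B) n := by
  refine baileySum_succ_eq (norm_pow_lt_one h1 four_ne_zero) (pow_ne_zero _ h0) 0 (-1) one_ne_zero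
    (by norm_num) (fun r => ?_) n
  rw [thetaTerm_sub h0, pow_zpow', pow_zpow']
  have e : h ^ (A * (-1) ^ 2 - 2 * A * -1 * r + B * -1 - 2 * B * r) *
      h ^ (((4 : ℕ) : ℤ) * (1 * (-1 - r))) = h ^ (((4 : ℕ) : ℤ) * (1 * r)) := by
    rw [← zpow_add₀ h0]; congr 1; subst hAB; push_cast; ring
  rw [← e, show ((-1 : ℂ) ^ (-1 : ℤ)) = -1 by norm_num]
  ring

lemma baileySum_thetaTerm_neg (q : ℂ) (A B n : ℤ) :
    baileySum q 0 1 (thetaTerm h A (-B)) n = baileySum q 0 1 (thetaTerm h A B) n := by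
  unfold baileySum
  rw [← tsum_int_reflect _ 0]
  refine tsum_congr fun r => ?_
  rw [show (1 : ℤ) * (0 - r) = -0 - 1 * r by ring, baileyKer_reflect, zero_sub, thetaTerm_neg,
    neg_neg]

lemma baileySum_G_combine (h0 : h ≠ 0) (h1 : ‖h‖ < 1) (n : ℕ) :
    baileySum (h ^ 4) 0 1 (thetaTerm h 7 1) n +
        (h ^ 4) ^ (n + 1) * baileySum (h ^ 4) 1 1 (thetaTerm h 7 5) n =
      baileySum (h ^ 4) 1 1 (thetaTerm h 7 1) n := by
  have hq := norm_pow_lt_one h1 four_ne_zero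
  have e : ∀ r, thetaTerm h 7 1 r * baileyKer (h ^ 4) 0 n (1 * r) =
      thetaTerm h 7 1 r * baileyKer (h ^ 4) 1 n (1 * r) -
      (h ^ 4) ^ (n + 1) * (thetaTerm h 7 5 r * baileyKer (h ^ 4) 1 n (1 * r)) := fun r => by
    have h2 := baileyKer_lower hq 0 n (1 * r)
    rw [zero_add] at h2
    rw [← h2, ← thetaTerm_mul_zpow h0 (show 7 * r ^ 2 + 5 * r = 7 * r ^ 2 + 1 * r + 4 * r by ring),
      show (n : ℤ) + 1 * r + 1 = ((n + 1 : ℕ) : ℤ) + r by push_cast; ring,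
      zpow_add₀ (pow_ne_zero _ h0), zpow_natCast, pow_zpow' h 4 r]
    push_cast
    ring
  unfold baileySum
  rw [tsum_congr e, Summable.tsum_sub, tsum_mul_left]
  · ring
  · exact summable_mul_baileyKer _ _ _ one_ne_zero _
  · exact (summable_mul_baileyKer _ _ _ one_ne_zero _).mul_left _

variable {β β' : ℕ → ℂ}

lemma baileyChain_G_zero_zero (h0 : h ≠ 0) (h1 : ‖h‖ < 1)
    (hβ : ∀ k : ℕ, β k = baileySum (h ^ 4) 0 1 (thetaTerm h 3 1) k) :
    baileyChain (h ^ 4) 0 0 β =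
      (qPochInf (h ^ 4) (h ^ 4))⁻¹ * ∑' r, thetaTerm h 11 1 r := by
  have hq := norm_pow_lt_one h1 four_ne_zero
  unfold baileyChain
  simp_rw [baileyStep_eq hq 0 one_ne_zero (one_mul_nonneg_or · 0 (by norm_num)) hβ
    (thetaTerm_mul_pow_four h0 3 1 7 1 0 (by norm_num) (by norm_num))]
  exact tsum_baileySum' hq 0 (one_mul_nonneg_or · 0 (by norm_num))
    (summable_thetaTerm h0 h1 (by norm_num))
    (thetaTerm_mul_pow_four h0 7 1 11 1 0 (by norm_num) (by norm_num))

/-- Reflection replaces `(3, 1)` by `(3, -1)`; as `3 = -1 + 4` the parameter may be raised to `a =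
1`, and the step lands on `(7, 3)`. -/
lemma baileyStep_G_one (h0 : h ≠ 0) (h1 : ‖h‖ < 1)
    (hβ : ∀ k : ℕ, β k = baileySum (h ^ 4) 0 1 (thetaTerm h 3 1) k) (n : ℕ) :
    baileyStep (h ^ 4) 1 β n = baileySum (h ^ 4) 1 1 (thetaTerm h 7 3) n := by
  refine baileyStep_eq (norm_pow_lt_one h1 four_ne_zero) 1 one_ne_zero
    (one_mul_nonneg_or · 1 le_rfl) (fun k => ?_)
    (thetaTerm_mul_pow_four h0 3 (-1) 7 3 1 (by norm_num) (by norm_num)) n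
  rw [hβ, ← baileySum_thetaTerm_neg]
  exact (baileySum_one_eq_zero h0 h1 (by norm_num) k).symm

lemma baileyChain_G_zero_one (h0 : h ≠ 0) (h1 : ‖h‖ < 1)
    (hβ : ∀ k : ℕ, β k = baileySum (h ^ 4) 0 1 (thetaTerm h 3 1) k) :
    baileyChain (h ^ 4) 0 1 β =
      (qPochInf (h ^ 4) (h ^ 4))⁻¹ * ∑' r, thetaTerm h 11 3 r := by
  have hq := norm_pow_lt_one h1 four_ne_zero
  unfold baileyChain
  simp_rw [baileyStep_G_one h0 h1 hβ, baileySum_one_eq_zero h0 h1 (show (7 : ℤ) = 3 + 4 by norm_num)]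
  exact tsum_baileySum' hq 0 (one_mul_nonneg_or · 0 (by norm_num))
    (summable_thetaTerm h0 h1 (by norm_num))
    (thetaTerm_mul_pow_four h0 7 3 11 3 0 (by norm_num) (by norm_num))

lemma baileyChain_G_one_one (h0 : h ≠ 0) (h1 : ‖h‖ < 1)
    (hβ : ∀ k : ℕ, β k = baileySum (h ^ 4) 0 1 (thetaTerm h 3 1) k) :
    baileyChain (h ^ 4) 1 1 β =
      (qPochInf (h ^ 4) (h ^ 4))⁻¹ * ∑' r, thetaTerm h 11 7 r := by
  have hq := norm_pow_lt_one h1 four_ne_zero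
  unfold baileyChain
  simp_rw [baileyStep_G_one h0 h1 hβ]
  exact tsum_baileySum' hq 1 (one_mul_nonneg_or · 1 (by norm_num))
    (summable_thetaTerm h0 h1 (by norm_num))
    (thetaTerm_mul_pow_four h0 7 3 11 7 1 (by norm_num) (by norm_num))

lemma baileyStep_G_one' (h0 : h ≠ 0) (h1 : ‖h‖ < 1)
    (hβ' : ∀ k : ℕ, β' k = baileySum (h ^ 4) 1 1 (thetaTerm h 3 1) k) (n : ℕ) :
    baileyStep (h ^ 4) 1 β' n = baileySum (h ^ 4) 1 1 (thetaTerm h 7 5) n :=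
  baileyStep_eq (norm_pow_lt_one h1 four_ne_zero) 1 one_ne_zero
    (one_mul_nonneg_or · 1 le_rfl) hβ'
    (thetaTerm_mul_pow_four h0 3 1 7 5 1 (by norm_num) (by norm_num)) n

lemma baileyChain_G_one_one' (h0 : h ≠ 0) (h1 : ‖h‖ < 1)
    (hβ' : ∀ k : ℕ, β' k = baileySum (h ^ 4) 1 1 (thetaTerm h 3 1) k) :
    baileyChain (h ^ 4) 1 1 β' =
      (qPochInf (h ^ 4) (h ^ 4))⁻¹ * ∑' r, thetaTerm h 11 9 r := by
  have hq := norm_pow_lt_one h1 four_ne_zero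
  unfold baileyChain
  simp_rw [baileyStep_G_one' h0 h1 hβ']
  exact tsum_baileySum' hq 1 (one_mul_nonneg_or · 1 (by norm_num))
    (summable_thetaTerm h0 h1 (by norm_num))
    (thetaTerm_mul_pow_four h0 7 5 11 9 1 (by norm_num) (by norm_num))

/-- Since `q · q^(n²+2n) = q^(n²+n) q^(n+1)`, the two inner sums merge by `baileySum_G_combine` into
the `a = 1` transform of `(7, 1)`, and the last step gives `(11, 5)`. -/
lemma baileyChain_G_add (h0 : h ≠ 0) (h1 : ‖h‖ < 1)
    (hβ : ∀ k : ℕ, β k = baileySum (h ^ 4) 0 1 (thetaTerm h 3 1) k)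
    (hβ' : ∀ k : ℕ, β' k = baileySum (h ^ 4) 1 1 (thetaTerm h 3 1) k) :
    baileyChain (h ^ 4) 1 0 β + h ^ 4 * baileyChain (h ^ 4) 2 1 β' =
      (qPochInf (h ^ 4) (h ^ 4))⁻¹ * ∑' r, thetaTerm h 11 5 r := by
  have hq := norm_pow_lt_one h1 four_ne_zero
  have hx := summable_thetaTerm h0 h1 (A := 3) (B := 1) (by norm_num)
  have hb : ∃ M : ℝ, ∀ n, ‖β n‖ ≤ M := by
    obtain ⟨M, hM⟩ := norm_baileySum_le hq 0 1 hx
    exact ⟨M, fun n => by rw [hβ]; exact hM n⟩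
  have hb' : ∃ M : ℝ, ∀ n, ‖β' n‖ ≤ M := by
    obtain ⟨M, hM⟩ := norm_baileySum_le hq 1 1 hx
    exact ⟨M, fun n => by rw [hβ']; exact hM n⟩
  unfold baileyChain
  rw [← tsum_mul_left, ← (summable_baileyChain hq 1 0 hb).tsum_add
    ((summable_baileyChain hq 2 1 hb').mul_left _),
    ← tsum_baileySum' hq 1 (one_mul_nonneg_or · 1 (by norm_num))
    (summable_thetaTerm h0 h1 (A := 7) (B := 1) (by norm_num))
    (thetaTerm_mul_pow_four h0 7 1 11 5 1 (by norm_num) (by norm_num))]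
  refine tsum_congr fun n => ?_
  have e0 := baileyStep_eq hq 0 one_ne_zero (one_mul_nonneg_or · 0 (by norm_num)) hβ
    (thetaTerm_mul_pow_four h0 3 1 7 1 0 (by norm_num) (by norm_num)) n
  have e2 := baileySum_G_combine h0 h1 n
  push_cast at e0 ⊢
  rw [baileyStep_G_one' h0 h1 hβ', e0, ← e2]
  ring

end ClassG

section ClassC

variable {q : ℂ}

/-- On even indices `s = 2r` a step sends `(A, B)` to `(A + 4, B + 2a)`, and `A = B + 2` is the
condition for switching between `a = 1` and `a = 2`. -/
lemma thetaTerm_mul_zpow_even (h0 : q ≠ 0) (A B A' B' : ℤ) (a : ℕ) (hA : A' = A + 4)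
    (hB : B' = B + 2 * a) (r : ℤ) :
    thetaTerm q A B r * q ^ ((2 * r) ^ 2 + a * (2 * r)) = thetaTerm q A' B' r := by
  refine thetaTerm_mul_zpow h0 ?_
  subst hA hB; ring

lemma baileySum_two_eq_one (h0 : q ≠ 0) (hq : ‖q‖ < 1) {A B : ℤ} (hAB : A = B + 2) (n : ℤ) :
    baileySum q 2 2 (thetaTerm q A B) n = baileySum q 1 2 (thetaTerm q A B) n := by
  refine baileySum_succ_eq hq h0 1 (-1) two_ne_zero (by norm_num) (fun r => ?_) n
  rw [thetaTerm_sub h0]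
  have e : q ^ (A * (-1) ^ 2 - 2 * A * -1 * r + B * -1 - 2 * B * r) *
      q ^ (2 * (-1 - r)) = q ^ (2 * r) := by
    rw [← zpow_add₀ h0]; congr 1; subst hAB; push_cast; ring
  rw [← e, show ((-1 : ℂ) ^ (-1 : ℤ)) = -1 by norm_num]
  ring

variable {β β' : ℕ → ℂ}

lemma baileyChain_C_zero_zero (h0 : q ≠ 0) (hq : ‖q‖ < 1)
    (hβ : ∀ k : ℕ, β k = baileySum q 0 2 (thetaTerm q 3 1) k) :
    baileyChain q 0 0 β = (qPochInf q q)⁻¹ * ∑' r, thetaTerm q 11 1 r := by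
  unfold baileyChain
  simp_rw [baileyStep_eq hq 0 two_ne_zero (two_mul_nonneg_or · 0 (by norm_num)) hβ
    (thetaTerm_mul_zpow_even h0 3 1 7 1 0 (by norm_num) (by norm_num))]
  exact tsum_baileySum' hq 0 (two_mul_nonneg_or · 0 (by norm_num))
    (summable_thetaTerm h0 hq (by norm_num))
    (thetaTerm_mul_zpow_even h0 7 1 11 1 0 (by norm_num) (by norm_num))

lemma baileyStep_C_one (h0 : q ≠ 0) (hq : ‖q‖ < 1)
    (hβ' : ∀ k : ℕ, β' k = baileySum q 1 2 (thetaTerm q 3 1) k) (n : ℕ) :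
    baileyStep q 1 β' n = baileySum q 1 2 (thetaTerm q 7 3) n :=
  baileyStep_eq hq 1 two_ne_zero (two_mul_nonneg_or · 1 (by norm_num)) hβ'
    (thetaTerm_mul_zpow_even h0 3 1 7 3 1 (by norm_num) (by norm_num)) n

lemma baileyChain_C_one_one (h0 : q ≠ 0) (hq : ‖q‖ < 1)
    (hβ' : ∀ k : ℕ, β' k = baileySum q 1 2 (thetaTerm q 3 1) k) :
    baileyChain q 1 1 β' = (qPochInf q q)⁻¹ * ∑' r, thetaTerm q 11 5 r := by
  unfold baileyChain
  simp_rw [baileyStep_C_one h0 hq hβ']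
  exact tsum_baileySum' hq 1 (two_mul_nonneg_or · 1 (by norm_num))
    (summable_thetaTerm h0 hq (by norm_num))
    (thetaTerm_mul_zpow_even h0 7 3 11 5 1 (by norm_num) (by norm_num))

lemma baileyStep_C_two (h0 : q ≠ 0) (hq : ‖q‖ < 1)
    (hβ' : ∀ k : ℕ, β' k = baileySum q 1 2 (thetaTerm q 3 1) k) (n : ℕ) :
    baileyStep q 2 β' n = baileySum q 2 2 (thetaTerm q 7 5) n :=
  baileyStep_eq hq 2 two_ne_zero (two_mul_nonneg_or · 2 le_rfl)
    (fun k => (hβ' k).trans (baileySum_two_eq_one h0 hq (by norm_num) k).symm)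
    (thetaTerm_mul_zpow_even h0 3 1 7 5 2 (by norm_num) (by norm_num)) n

lemma baileyChain_C_two_two (h0 : q ≠ 0) (hq : ‖q‖ < 1)
    (hβ' : ∀ k : ℕ, β' k = baileySum q 1 2 (thetaTerm q 3 1) k) :
    baileyChain q 2 2 β' = (qPochInf q q)⁻¹ * ∑' r, thetaTerm q 11 9 r := by
  unfold baileyChain
  simp_rw [baileyStep_C_two h0 hq hβ']
  exact tsum_baileySum' hq 2 (two_mul_nonneg_or · 2 le_rfl)
    (summable_thetaTerm h0 hq (by norm_num))
    (thetaTerm_mul_zpow_even h0 7 5 11 9 2 (by norm_num) (by norm_num))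

lemma baileyChain_C_one_two (h0 : q ≠ 0) (hq : ‖q‖ < 1)
    (hβ' : ∀ k : ℕ, β' k = baileySum q 1 2 (thetaTerm q 3 1) k) :
    baileyChain q 1 2 β' = (qPochInf q q)⁻¹ * ∑' r, thetaTerm q 11 7 r := by
  unfold baileyChain
  simp_rw [baileyStep_C_two h0 hq hβ', baileySum_two_eq_one h0 hq (show (7 : ℤ) = 5 + 2 by norm_num)]
  exact tsum_baileySum' hq 1 (two_mul_nonneg_or · 1 (by norm_num))
    (summable_thetaTerm h0 hq (by norm_num))
    (thetaTerm_mul_zpow_even h0 7 5 11 7 1 (by norm_num) (by norm_num))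

/-- Termwise `1 - (1 - q^(n+1-k)) = q^(n+1-k)`, whose product with the extra `q^k` is the constant
`q^(n+1)`. -/
lemma baileyStep_succ_sub {q : ℂ} (hq : ‖q‖ < 1) (B : ℕ) (β : ℕ → ℂ) (n : ℕ) :
    baileyStep q (B + 1) β (n + 1) - baileyStep q (B + 1) β n =
      q ^ (n + 1) * baileyStep q B β (n + 1) := by
  have hn : baileyStep q (B + 1) β n = ∑ k ∈ Finset.range (n + 1 + 1),
      invPoch q ((n : ℤ) - k) * (q ^ (k ^ 2 + (B + 1) * k) * β k) := by
    rw [Finset.sum_range_succ, invPoch_of_neg q (show (n : ℤ) - ((n + 1 : ℕ) : ℤ) < 0 by simp)]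
    simp [baileyStep]
  rw [hn]
  unfold baileyStep
  rw [← Finset.sum_sub_distrib, Finset.mul_sum]
  refine Finset.sum_congr rfl fun k hk => ?_
  have hk' : k ≤ n + 1 := by simpa [Nat.lt_succ_iff] using hk
  have h := one_sub_zpow_mul_invPoch hq (((n + 1 : ℕ) : ℤ) - k)
  rw [show ((n + 1 : ℕ) : ℤ) - k - 1 = (n : ℤ) - k by push_cast; ring,
    show ((n + 1 : ℕ) : ℤ) - (k : ℤ) = ((n + 1 - k : ℕ) : ℤ) by lia, zpow_natCast] at h
  rw [← h, show ((n + 1 : ℕ) : ℤ) - (k : ℤ) = ((n + 1 - k : ℕ) : ℤ) by lia]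
  have e : q ^ (n + 1) = q ^ (n + 1 - k) * q ^ k := by rw [← pow_add]; congr 1; lia
  rw [e]
  ring

lemma baileySum_C_combine (h0 : q ≠ 0) (hq : ‖q‖ < 1) (n : ℕ) :
    baileySum q 1 2 (thetaTerm q 7 3) n +
        q ^ (n + 1) * baileySum q 0 2 (thetaTerm q 7 1) ((n + 1 : ℕ) : ℤ) =
      baileySum q 0 2 (thetaTerm q 7 3) ((n + 1 : ℕ) : ℤ) := by
  have e : ∀ r, thetaTerm q 7 3 r * baileyKer q 1 n (2 * r) =
      thetaTerm q 7 3 r * baileyKer q 0 ((n + 1 : ℕ) : ℤ) (2 * r) -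
      q ^ (n + 1) * (thetaTerm q 7 1 r * baileyKer q 0 ((n + 1 : ℕ) : ℤ) (2 * r)) := fun r => by
    have h3 := baileyKer_pred hq 0 ((n + 1 : ℕ) : ℤ) (2 * r)
    rw [zero_add, show ((n + 1 : ℕ) : ℤ) - 1 = n by simp] at h3
    rw [← h3, ← thetaTerm_mul_zpow h0
      (show 7 * r ^ 2 + 1 * r = 7 * r ^ 2 + 3 * r + -(2 * r) by ring),
      sub_eq_add_neg ((n + 1 : ℕ) : ℤ), zpow_add₀ h0, zpow_natCast]
    ring
  unfold baileySum
  rw [tsum_congr e, Summable.tsum_sub, tsum_mul_left]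
  · ring
  · exact summable_mul_baileyKer _ _ _ two_ne_zero _
  · exact (summable_mul_baileyKer _ _ _ two_ne_zero _).mul_left _

lemma baileyChain_C_add (h0 : q ≠ 0) (hq : ‖q‖ < 1)
    (hβ : ∀ k : ℕ, β k = baileySum q 0 2 (thetaTerm q 3 1) k)
    (hβ' : ∀ k : ℕ, β' k = baileySum q 1 2 (thetaTerm q 3 1) k) :
    baileyChain q 0 1 β + q ^ 2 * baileyChain q 2 3 β' =
      (qPochInf q q)⁻¹ * ∑' r, thetaTerm q 11 3 r := by
  have hx := summable_thetaTerm h0 hq (A := 3) (B := 1) (by norm_num)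
  have hb : ∃ M : ℝ, ∀ n, ‖β n‖ ≤ M := by
    obtain ⟨M, hM⟩ := norm_baileySum_le hq 0 2 hx
    exact ⟨M, fun n => by rw [hβ]; exact hM n⟩
  have hb' : ∃ M : ℝ, ∀ n, ‖β' n‖ ≤ M := by
    obtain ⟨M, hM⟩ := norm_baileySum_le hq 1 2 hx
    exact ⟨M, fun n => by rw [hβ']; exact hM n⟩
  have hββ' : ∀ m : ℕ, β m = (1 - q ^ (2 * m + 1)) * β' m := fun m => by
    rw [hβ, hβ', baileySum_zero_eq_mul_one_even h0 hq]
  -- Because `β = (1 - q^(2m+1)) β'`, the difference `β' - β` carries the weight that raises `B`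
  -- from 1 to 3.
  have hstep : ∀ n, q * baileyStep q 3 β' n = baileyStep q 1 β' n - baileyStep q 1 β n := fun n => by
    unfold baileyStep
    rw [← Finset.sum_sub_distrib, Finset.mul_sum]
    exact Finset.sum_congr rfl fun m _ => by rw [hββ' m]; ring
  have hS := summable_baileyChain hq 0 1 hb
  unfold baileyChain
  -- As `q² q^(n²+2n) = q · q^((n+1)²)`, the second chain aligns with the first from index 1 on; the
  -- term at 0 is split off.
  rw [hS.tsum_eq_zero_add, ← tsum_mul_left, add_assoc,
    ← ((summable_nat_add_iff 1).mpr hS).tsum_add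
    ((summable_baileyChain hq 2 3 hb').mul_left _),
    ← tsum_baileySum' hq 0 (two_mul_nonneg_or · 0 (by norm_num))
    (summable_thetaTerm h0 hq (A := 7) (B := 3) (by norm_num))
    (thetaTerm_mul_zpow_even h0 7 3 11 3 0 (by norm_num) (by norm_num)),
    Summable.tsum_eq_zero_add (f := fun n : ℕ => q ^ (n ^ 2 + 0 * n) *
      baileySum q ((0 : ℕ) : ℤ) 2 (thetaTerm q 7 3) n)]
  · congr 1
    · simp [baileyStep, hβ, baileySum_at_zero, thetaTerm]
    · refine tsum_congr fun n => ?_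
      have e1 := hstep n
      have e2 := baileyStep_succ_sub hq 0 β n
      have e3 := baileyStep_eq hq 0 two_ne_zero (two_mul_nonneg_or · 0 (by norm_num)) hβ
        (thetaTerm_mul_zpow_even h0 3 1 7 1 0 (by norm_num) (by norm_num)) (n + 1)
      have e4 := baileyStep_C_one h0 hq hβ' n
      have e5 := baileySum_C_combine h0 hq n
      rw [zero_add] at e2
      simp only [Nat.cast_zero] at e3 ⊢
      rw [← e5, ← e3, ← e4]
      linear_combination q ^ ((n + 1) ^ 2) * (e1 + e2)
  · have := (summable_pow_mul_baileySum hq 0 2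
      (summable_thetaTerm h0 hq (A := 7) (B := 3) (by norm_num))).prod
    simpa only [tsum_mul_left, baileySum] using this

end ClassC

end MizunoNahm
-- Absolute convergence, and Nahm sums as Bailey chains
namespace MizunoNahm
open Filter Topology

lemma qpow_eq_pow (τ : ℂ) {r s : ℚ} {n : ℕ} (h : r = n * s) : qpow τ r = qpow τ s ^ n := by
  unfold qpow
  rw [← Complex.exp_nat_mul, h]
  push_cast
  ring_nf

lemma qpow_mul_qpow (τ : ℂ) (r s : ℚ) : qpow τ r * qpow τ s = qpow τ (r + s) := by
  unfold qpow
  rw [← Complex.exp_add]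
  push_cast
  ring_nf

lemma qpow_ne_zero (τ : ℂ) (r : ℚ) : qpow τ r ≠ 0 := Complex.exp_ne_zero _

lemma qvar_eq_qpow (τ : ℂ) : qvar τ = qpow τ 1 := by simp [qvar, qpow]

lemma norm_qpow_lt_one {τ : ℂ} (hτ : 0 < τ.im) {r : ℚ} (hr : 0 < r) : ‖qpow τ r‖ < 1 := by
  have e : (2 * (Real.pi : ℂ) * Complex.I * (r : ℂ) * τ) =
      ((2 * Real.pi * (r : ℝ) : ℝ) : ℂ) * (Complex.I * τ) := by push_cast; ring
  rw [qpow, e, Complex.norm_exp, Complex.re_ofReal_mul, Real.exp_lt_one_iff]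
  have hr' : (0 : ℝ) < r := by exact_mod_cast hr
  have : (Complex.I * τ).re = -τ.im := by simp
  rw [this]
  have := Real.pi_pos
  have : 0 < 2 * Real.pi * r * τ.im := by positivity
  linarith

lemma summable_pow_sq_mul_pow {a c : ℝ} (ha : 0 ≤ a) (ha1 : a < 1) (hc : 0 ≤ c) :
    Summable fun n : ℕ => a ^ n ^ 2 * c ^ n := by
  have ht : Tendsto (fun n : ℕ => a ^ n * c) atTop (𝓝 0) := by
    simpa using (tendsto_pow_atTop_nhds_zero_of_lt_one ha ha1).mul_const c
  refine Summable.of_norm_bounded_eventually_nat (summable_geometric_two) ?_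
  filter_upwards [ht.eventually (ge_mem_nhds (show (0 : ℝ) < 1 / 2 by norm_num))] with n hn
  rw [Real.norm_of_nonneg (by positivity), sq, pow_mul, ← mul_pow]
  exact pow_le_pow_left₀ (by positivity) hn n

lemma summable_quadratic_triple {a u v w : ℝ} (ha : 0 ≤ a) (ha1 : a < 1) (hu : 0 ≤ u) (hv : 0 ≤ v)
    (hw : 0 ≤ w) : Summable fun n : ℕ × ℕ × ℕ =>
      (a ^ n.1 ^ 2 * u ^ n.1) * ((a ^ n.2.1 ^ 2 * v ^ n.2.1) * (a ^ n.2.2 ^ 2 * w ^ n.2.2)) := by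
  have h2 : Summable fun n : ℕ × ℕ => (a ^ n.1 ^ 2 * v ^ n.1) * (a ^ n.2 ^ 2 * w ^ n.2) :=
    Summable.mul_of_nonneg (f := fun n : ℕ => a ^ n ^ 2 * v ^ n)
      (g := fun n : ℕ => a ^ n ^ 2 * w ^ n) (summable_pow_sq_mul_pow ha ha1 hv)
      (summable_pow_sq_mul_pow ha ha1 hw) (by intro n; simp only [Pi.zero_apply]; positivity)
      (by intro n; simp only [Pi.zero_apply]; positivity)
  exact Summable.mul_of_nonneg (f := fun n : ℕ => a ^ n ^ 2 * u ^ n)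
      (g := fun n : ℕ × ℕ => (a ^ n.1 ^ 2 * v ^ n.1) * (a ^ n.2 ^ 2 * w ^ n.2))
      (summable_pow_sq_mul_pow ha ha1 hu)
      h2 (by intro n; simp only [Pi.zero_apply]; positivity)
      (by intro n; simp only [Pi.zero_apply]; positivity)

/-- The reciprocal factorials are bounded and the exponent dominates `i² + j² + k²`, which beats
geometric growth in `u`, `v`, `w` of any size. -/
lemma summable_nahm {a q₁ q₂ q₃ : ℂ} (ha : ‖a‖ < 1) (h1 : ‖q₁‖ < 1) (h2 : ‖q₂‖ < 1)
    (h3 : ‖q₃‖ < 1) (u v w : ℂ) {N : ℕ × ℕ × ℕ → ℕ}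
    (hN : ∀ n, n.1 ^ 2 + n.2.1 ^ 2 + n.2.2 ^ 2 ≤ N n) :
    Summable fun n : ℕ × ℕ × ℕ => a ^ N n * u ^ n.1 * v ^ n.2.1 * w ^ n.2.2 /
      (qPoch q₁ q₁ n.1 * qPoch q₂ q₂ n.2.1 * qPoch q₃ q₃ n.2.2) := by
  obtain ⟨M₁, hM₁, hb₁⟩ := exists_norm_qPoch_inv_le h1 h1
  obtain ⟨M₂, hM₂, hb₂⟩ := exists_norm_qPoch_inv_le h2 h2
  obtain ⟨M₃, hM₃, hb₃⟩ := exists_norm_qPoch_inv_le h3 h3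
  refine Summable.of_norm_bounded ((summable_quadratic_triple (norm_nonneg a) ha (norm_nonneg u)
    (norm_nonneg v) (norm_nonneg w)).mul_right (M₁ * M₂ * M₃)) fun n => ?_
  rw [div_eq_mul_inv, mul_inv, mul_inv]
  have e : ‖a‖ ^ N n ≤ ‖a‖ ^ n.1 ^ 2 * ‖a‖ ^ n.2.1 ^ 2 * ‖a‖ ^ n.2.2 ^ 2 := by
    rw [← pow_add, ← pow_add]
    exact pow_le_pow_of_le_one (norm_nonneg _) ha.le (hN n)
  have := hb₁ n.1
  have := hb₂ n.2.1
  have := hb₃ n.2.2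
  simp only [norm_mul, norm_pow]
  calc ‖a‖ ^ N n * ‖u‖ ^ n.1 * ‖v‖ ^ n.2.1 * ‖w‖ ^ n.2.2 *
        (‖(qPoch q₁ q₁ n.1)⁻¹‖ * ‖(qPoch q₂ q₂ n.2.1)⁻¹‖ * ‖(qPoch q₃ q₃ n.2.2)⁻¹‖)
      ≤ (‖a‖ ^ n.1 ^ 2 * ‖a‖ ^ n.2.1 ^ 2 * ‖a‖ ^ n.2.2 ^ 2) * ‖u‖ ^ n.1 * ‖v‖ ^ n.2.1 *
        ‖w‖ ^ n.2.2 * (M₁ * M₂ * M₃) := by gcongr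
    _ = _ := by ring

lemma termF_eq (u v w τ : ℂ) (n : ℕ × ℕ × ℕ) :
    termF u v w τ n = qpow τ (1 / 2) ^ (n.1 ^ 2 + 2 * n.2.1 ^ 2 + 4 * n.2.2 ^ 2 +
        2 * n.1 * n.2.2 + 4 * n.2.1 * n.2.2) * u ^ n.1 * v ^ n.2.1 * w ^ n.2.2 /
      (qPoch (qvar τ) (qvar τ) n.1 * qPoch (qvar τ) (qvar τ) n.2.1 *
        qPoch (qvar τ ^ 2) (qvar τ ^ 2) n.2.2) := by
  unfold termF
  simp only
  rw [qpow_eq_pow τ (s := 1 / 2) (n := n.1 ^ 2 + 2 * n.2.1 ^ 2 + 4 * n.2.2 ^ 2 +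
        2 * n.1 * n.2.2 + 4 * n.2.1 * n.2.2)]
  push_cast
  ring

lemma norm_qvar_lt_one {τ : ℂ} (hτ : 0 < τ.im) : ‖qvar τ‖ < 1 := by
  rw [qvar_eq_qpow]; exact norm_qpow_lt_one hτ one_pos

lemma summable_termF (u v w : ℂ) {τ : ℂ} (hτ : 0 < τ.im) : Summable (termF u v w τ) := by
  have hq := norm_qvar_lt_one hτ
  refine (summable_nahm (norm_qpow_lt_one hτ (show (0 : ℚ) < 1 / 2 by norm_num)) hq hq
    (norm_pow_lt_one hq two_ne_zero) u v w fun n => ?_).congr fun n => (termF_eq u v w τ n).symm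
  nlinarith [Nat.zero_le (n.1 * n.2.2), Nat.zero_le (n.2.1 * n.2.2)]

lemma summable_termG (u v w : ℂ) {τ : ℂ} (hτ : 0 < τ.im) : Summable (termG u v w τ) := by
  have hq := norm_qvar_lt_one hτ
  have hq2 := norm_pow_lt_one hq two_ne_zero
  refine summable_nahm hq hq hq2 hq2 u v w
    (N := fun n => n.1 ^ 2 + 2 * n.2.1 ^ 2 + n.2.2 ^ 2 + 2 * n.1 * n.2.1 + n.1 * n.2.2) fun n => ?_
  nlinarith [Nat.zero_le (n.1 * n.2.2), Nat.zero_le (n.1 * n.2.1)]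

lemma tsum_triple {f : ℕ × ℕ × ℕ → ℂ} (hf : Summable f) {g : ℕ × ℕ → ℂ}
    (h : ∀ b, ∑' i, f (i, b) = g b) : Summable g ∧ ∑' n, f n = ∑' b, g b := by
  have hf' : Summable fun x : (ℕ × ℕ) × ℕ => f (x.2, x.1) :=
    (Equiv.prodComm (ℕ × ℕ) ℕ).summable_iff.mpr hf
  obtain rfl : (fun b => ∑' i, f (i, b)) = g := funext h
  refine ⟨hf'.prod, ?_⟩
  rw [← hf'.tsum_prod]
  exact ((Equiv.prodComm (ℕ × ℕ) ℕ).tsum_eq f).symm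

/-- A Nahm sum whose first index has been separated as an Euler series is a Bailey chain. -/
lemma tsum_eq_baileyChain {p : ℂ} (h1 : ‖p‖ < 1) {f : ℕ × ℕ × ℕ → ℂ} (hf : Summable f) (A B s : ℕ)
    (β : ℕ → ℂ) (h : ∀ i j k : ℕ, f (i, j, k) = p ^ (i ^ 2 + 2 * i * (k + s)) * invPoch (p ^ 2) i *
      ((p ^ 2) ^ ((j + k) ^ 2 + A * (j + k)) * (invPoch (p ^ 2) j *
        ((p ^ 2) ^ (k ^ 2 + B * k) * β k)))) :
    ∑' n, f n = qPochInf (-p) (p ^ 2) *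
      baileyChain (p ^ 2) A B fun k => β k * (qPoch (-p) (p ^ 2) (k + s))⁻¹ := by
  have hq := norm_pow_lt_one h1 two_ne_zero
  have hC := qPochInf_ne_zero (norm_neg_lt_one h1) hq
  let W : ℕ → ℂ := fun n => (p ^ 2) ^ (n ^ 2 + A * n)
  let Γ : ℕ → ℂ := fun k => (p ^ 2) ^ (k ^ 2 + B * k) * (β k * (qPoch (-p) (p ^ 2) (k + s))⁻¹)
  have hg : ∀ b : ℕ × ℕ, ∑' i, f (i, b) = qPochInf (-p) (p ^ 2) *
      (W (b.1 + b.2) * (invPoch (p ^ 2) b.1 * Γ b.2)) := by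
    rintro ⟨j, k⟩
    have := eulerSum_eq h1 (k + s)
    unfold eulerSum at this
    rw [tsum_congr fun i => h i j k, tsum_mul_right, this]
    simp only [W, Γ]
    ring
  obtain ⟨hs, he⟩ := tsum_triple hf hg
  rw [he, tsum_mul_left, tsum_prod_invPoch W Γ ((summable_mul_left_iff hC).mp hs)]
  rfl

/-- The third argument is `q^(b+c)` because the weight regroups as `b j + (b+c) k = b (j+k) + c k`;
`a` shifts the Euler series. -/
lemma F_eq_baileyChain {τ : ℂ} (hτ : 0 < τ.im) (a b c : ℕ) :
    F (qvar τ ^ a) (qvar τ ^ b) (qvar τ ^ (b + c)) τ =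
      qPochInf (-qpow τ (1 / 2)) (qvar τ) * baileyChain (qvar τ) b c fun k =>
        (qPoch (qvar τ ^ 2) (qvar τ ^ 2) k * qPoch (-qpow τ (1 / 2)) (qvar τ) (k + a))⁻¹ := by
  have hq : qvar τ = qpow τ (1 / 2) ^ 2 := by
    rw [qvar_eq_qpow]; exact qpow_eq_pow τ (by norm_num)
  have h := tsum_eq_baileyChain (norm_qpow_lt_one hτ (show (0 : ℚ) < 1 / 2 by norm_num))
    (summable_termF (qvar τ ^ a) (qvar τ ^ b) (qvar τ ^ (b + c)) hτ) b c a
    (fun k => (qPoch (qvar τ ^ 2) (qvar τ ^ 2) k)⁻¹) (fun i j k => by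
      rw [termF_eq, invPoch_natCast, invPoch_natCast, hq, div_eq_mul_inv, mul_inv, mul_inv]
      ring)
  rw [← hq] at h
  simp_rw [mul_inv]
  exact h

/-- Triples of naturals whose first entry has a given parity, with the last entry brought to the
front. -/
def parityEquiv (σ : ℕ) (hσ : σ < 2) : ℕ × ℕ × ℕ ≃ {n : ℕ × ℕ × ℕ // n.1 ≡ σ [MOD 2]} where
  toFun n := ⟨(2 * n.2.2 + σ, n.2.1, n.1), by simp [Nat.ModEq]⟩
  invFun n := (n.1.2.2, n.1.2.1, n.1.1 / 2)
  left_inv n := by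
    ext <;> simp; lia
  right_inv n := by
    obtain ⟨⟨i, j, k⟩, h⟩ := n
    simp only [Nat.ModEq] at h
    ext <;> simp; lia

/-- With `i = 2m + σ`, the Euler index is the original `k` with shift `m + σ`, and the rest is
`2(j+m)² + 2m²` plus linear terms: a chain in base `q²`. The constant part of the exponent comes out
in front. -/
lemma G_eq_baileyChain {τ : ℂ} (hτ : 0 < τ.im) (σ : ℕ) (hσ : σ < 2) (b c : ℕ) :
    G σ (qvar τ ^ (b + c)) (qvar τ ^ (2 * b)) (qvar τ ^ σ) τ =
      qvar τ ^ (σ ^ 2 + (b + c) * σ) * (qPochInf (-qvar τ) (qvar τ ^ 2) *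
        baileyChain (qvar τ ^ 2) (σ + b) (σ + c) fun m =>
          (qPoch (qvar τ) (qvar τ) (2 * m + σ) * qPoch (-qvar τ) (qvar τ ^ 2) (m + σ))⁻¹) := by
  have hq := norm_qvar_lt_one hτ
  have hq0 : qvar τ ≠ 0 := Complex.exp_ne_zero _
  have hG : G σ (qvar τ ^ (b + c)) (qvar τ ^ (2 * b)) (qvar τ ^ σ) τ =
      ∑' n, qvar τ ^ (σ ^ 2 + (b + c) * σ) * ((qvar τ ^ (σ ^ 2 + (b + c) * σ))⁻¹ *
        termG (qvar τ ^ (b + c)) (qvar τ ^ (2 * b)) (qvar τ ^ σ) τ (parityEquiv σ hσ n)) := by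
    unfold G
    rw [← (parityEquiv σ hσ).tsum_eq]
    exact tsum_congr fun n => (mul_inv_cancel_left₀ (pow_ne_zero _ hq0) _).symm
  have hsum : Summable fun n => (qvar τ ^ (σ ^ 2 + (b + c) * σ))⁻¹ *
      termG (qvar τ ^ (b + c)) (qvar τ ^ (2 * b)) (qvar τ ^ σ) τ (parityEquiv σ hσ n) :=
    ((parityEquiv σ hσ).summable_iff.mpr ((summable_termG _ _ _ hτ).subtype _)).mul_left _
  rw [hG, tsum_mul_left, tsum_eq_baileyChain hq hsum (σ + b) (σ + c) σ
    (fun m => (qPoch (qvar τ) (qvar τ) (2 * m + σ))⁻¹)]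
  · simp_rw [mul_inv]
  · intro k j m
    rw [inv_mul_eq_iff_eq_mul₀ (pow_ne_zero _ hq0)]
    simp only [termG, parityEquiv, Equiv.coe_fn_mk]
    rw [invPoch_natCast, invPoch_natCast, div_eq_mul_inv, mul_inv, mul_inv]
    ring

/-- Splitting `(q; q)_{2m}` into odd and even factors and using `(q; q²)(-q; q²) = (q²; q⁴)`
exhibits the type C pair in base `q²`. -/
lemma inv_qPoch_two_mul (q : ℂ) (m : ℕ) :
    (qPoch q q (2 * m + 0) * qPoch (-q) (q ^ 2) (m + 0))⁻¹ =
      (qPoch (q ^ 2) (q ^ 2) m * qPoch (q ^ 2) ((q ^ 2) ^ 2) m)⁻¹ := by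
  rw [← qPoch_mul_neg q (q ^ 2), add_zero, add_zero, ← qPoch_odd_mul_even]
  congr 1; ring

lemma inv_qPoch_two_mul_add_one (q : ℂ) (m : ℕ) :
    (qPoch q q (2 * m + 1) * qPoch (-q) (q ^ 2) (m + 1))⁻¹ =
      (qPoch (q ^ 2) (q ^ 2) m * qPoch (q ^ 2) ((q ^ 2) ^ 2) (m + 1))⁻¹ := by
  rw [← qPoch_mul_neg q (q ^ 2), ← qPoch_even_mul_odd_succ]
  congr 1; ring

end MizunoNahm
-- Modular inversion of the theta series
namespace MizunoNahm
open Filter Topology Complex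

/-- The theta series `∑_r (-1)^r e^(π i t (r + x)²)`. -/
noncomputable def altTheta (t x : ℂ) : ℂ := ∑' r : ℤ, (-1) ^ r * exp (Real.pi * I * t * (r + x) ^ 2)

lemma neg_one_zpow_eq_exp (r : ℤ) : (-1 : ℂ) ^ r = exp (Real.pi * I * r) := by
  rw [← exp_pi_mul_I, ← exp_int_mul]; ring_nf

lemma altTheta_eq_jacobiTheta₂ (t x : ℂ) :
    altTheta t x = exp (Real.pi * I * t * x ^ 2) * jacobiTheta₂ (1 / 2 + t * x) t := by
  unfold altTheta jacobiTheta₂ jacobiTheta₂_term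
  rw [← tsum_mul_left]
  refine tsum_congr fun r => ?_
  rw [neg_one_zpow_eq_exp, ← exp_add, ← exp_add]
  congr 1; ring

lemma altTheta_one_sub (t x : ℂ) : altTheta t (1 - x) = -altTheta t x := by
  unfold altTheta
  rw [← tsum_int_reflect _ (-1), ← tsum_neg]
  refine tsum_congr fun r => ?_
  rw [zpow_sub₀ (by norm_num), zpow_neg, zpow_one, div_eq_mul_inv, ← zpow_neg, neg_one_zpow_neg,
    show ((((-1 : ℤ) - r : ℤ) : ℂ) + (1 - x)) ^ 2 = ((r : ℂ) + x) ^ 2 by push_cast; ring]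
  norm_num

/-- The term of the series dual to `altTheta` under Poisson summation. -/
noncomputable def dualTerm (t x : ℂ) (n : ℤ) : ℂ :=
  exp (Real.pi * I * t * (n + 1 / 2) ^ 2 + 2 * Real.pi * I * x * (n + 1 / 2))

lemma dualTerm_eq (t x : ℂ) (n : ℤ) : dualTerm t x n =
    exp (Real.pi * I * t / 4 + Real.pi * I * x) * jacobiTheta₂_term n (t / 2 + x) t := by
  unfold dualTerm jacobiTheta₂_term
  rw [← exp_add]
  congr 1; ring

lemma summable_dualTerm {t : ℂ} (ht : 0 < t.im) (x : ℂ) : Summable (dualTerm t x) := by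
  refine (((summable_jacobiTheta₂_term_iff (t / 2 + x) t).mpr ht).mul_left
    (exp (Real.pi * I * t / 4 + Real.pi * I * x))).congr fun n => ?_
  exact (dualTerm_eq t x n).symm

/-- This is Poisson summation, taken from `jacobiTheta₂` at `z = t/2 - x`: the sign `(-1)^r` moves
the dual frequencies to half-integers. -/
lemma altTheta_neg_inv {t : ℂ} (ht : 0 < t.im) (x : ℂ) :
    altTheta (-1 / t) x = (-I * t) ^ (1 / 2 : ℂ) * ∑' n, dualTerm t x n := by
  have ht0 : t ≠ 0 := by rintro rfl; simp at ht
  have hc : (-I * t) ^ (1 / 2 : ℂ) ≠ 0 := by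
    rw [Ne, cpow_eq_zero_iff]; simp [ht0]
  have h := jacobiTheta₂_functional_equation (t / 2 - x) t
  have hz : (t / 2 - x) / t = 1 / 2 + -1 / t * x := by field_simp; ring
  rw [hz] at h
  have hd : ∑' n, dualTerm t x n =
      exp (Real.pi * I * t / 4 - Real.pi * I * x) * jacobiTheta₂ (t / 2 - x) t := by
    unfold jacobiTheta₂ jacobiTheta₂_term dualTerm
    rw [← tsum_mul_left, ← tsum_int_reflect _ (-1)]
    refine tsum_congr fun n => ?_
    rw [← exp_add]
    congr 1; push_cast; ring
  rw [hd, h, altTheta_eq_jacobiTheta₂]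
  have e : exp (Real.pi * I * (-1 / t) * x ^ 2) = exp (Real.pi * I * t / 4 - Real.pi * I * x) *
      exp (-Real.pi * I * (t / 2 - x) ^ 2 / t) := by
    rw [← exp_add]
    congr 1; field_simp; ring
  rw [e]
  field_simp

/-- Splitting the dual series into residue classes modulo `N`. -/
lemma tsum_dualTerm {t : ℂ} (ht : 0 < t.im) (N : ℕ) [NeZero N] {x : ℂ}
    (hx : exp (2 * Real.pi * I * x * N) = -1) :
    ∑' n, dualTerm t x n = ∑ b : Fin N, exp (2 * Real.pi * I * x * ((b : ℕ) + 1 / 2)) *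
      altTheta ((N : ℂ) ^ 2 * t) (((b : ℕ) + 1 / 2) / N) := by
  have hN : (N : ℂ) ≠ 0 := NeZero.ne _
  have hs := summable_dualTerm ht x
  have hs' := (Int.divModEquiv N).symm.summable_iff.mpr hs
  have hs2 : Summable fun y : Fin N × ℤ => dualTerm t x ((Int.divModEquiv N).symm (y.2, y.1)) :=
    (Equiv.prodComm (Fin N) ℤ).summable_iff.mpr hs'
  rw [← (Int.divModEquiv N).symm.tsum_eq, ← (Equiv.prodComm (Fin N) ℤ).tsum_eq]
  refine (hs2.tsum_prod).trans ?_
  rw [tsum_fintype]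
  refine Finset.sum_congr rfl fun b _ => ?_
  unfold altTheta
  rw [← tsum_mul_left]
  refine tsum_congr fun l => ?_
  simp only [Int.divModEquiv_symm_apply, dualTerm]
  -- With `n = b + N l`, the hypothesis `hx` makes the phase of `N l` equal to `(-1)^l`.
  rw [← hx, ← exp_int_mul, ← exp_add, ← exp_add]
  congr 1
  push_cast
  field_simp
  ring

lemma ofReal_mul_cpow_half {r : ℝ} (hr : 0 < r) {z : ℂ} (hz : z ≠ 0) :
    ((r : ℂ) * z) ^ (1 / 2 : ℂ) = (Real.sqrt r : ℂ) * z ^ (1 / 2 : ℂ) := by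
  have hr' : (r : ℂ) ≠ 0 := by exact_mod_cast hr.ne'
  rw [cpow_def_of_ne_zero (mul_ne_zero hr' hz), cpow_def_of_ne_zero hz, log_ofReal_mul hr hz,
    add_mul, exp_add, Real.sqrt_eq_rpow, ofReal_cpow hr.le, cpow_def_of_ne_zero hr',
    ofReal_log hr.le]
  push_cast
  rfl

lemma exp_mul_add_exp_neg (θ : ℝ) :
    exp (θ * I) + exp (-(θ * I)) = ((2 * Real.cos θ : ℝ) : ℂ) := by
  push_cast
  rw [Complex.cos, ← neg_mul]
  ring

lemma im_mul_ofReal_pos {τ : ℂ} (hτ : 0 < τ.im) {r : ℝ} (hr : 0 < r) : 0 < ((r : ℂ) * τ).im := by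
  rw [im_ofReal_mul]; positivity

/-- Take `t = τ/2`, `N = 2`. The two residue classes are mirror images and fold to `2 cos(π/4) =
√2`, cancelling the `√(1/2)` from the automorphy factor. -/
lemma altTheta_two_neg_inv {τ : ℂ} (hτ : 0 < τ.im) :
    altTheta (2 * (-1 / τ)) (1 / 4) = (-I * τ) ^ (1 / 2 : ℂ) * altTheta (2 * τ) (1 / 4) := by
  have hτ0 : τ ≠ 0 := by rintro rfl; simp at hτ
  have ht := im_mul_ofReal_pos hτ (show (0 : ℝ) < 1 / 2 by norm_num)
  have h := altTheta_neg_inv ht (1 / 4)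
  rw [tsum_dualTerm ht 2 (by
    rw [← exp_pi_mul_I]; congr 1; push_cast; ring)] at h
  rw [show -1 / (((1 / 2 : ℝ) : ℂ) * τ) = 2 * (-1 / τ) by push_cast; field_simp] at h
  rw [h, show -I * (((1 / 2 : ℝ) : ℂ) * τ) = ((1 / 2 : ℝ) : ℂ) * (-I * τ) by ring,
    ofReal_mul_cpow_half (by norm_num) (mul_ne_zero (neg_ne_zero.mpr I_ne_zero) hτ0)]
  simp only [Fin.sum_univ_two]
  rw [show ((2 : ℕ) : ℂ) ^ 2 * (((1 / 2 : ℝ) : ℂ) * τ) = 2 * τ by push_cast; ring,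
    show ((((0 : Fin 2) : ℕ) : ℂ) + 1 / 2) / ((2 : ℕ) : ℂ) = 1 / 4 by norm_num,
    show ((((1 : Fin 2) : ℕ) : ℂ) + 1 / 2) / ((2 : ℕ) : ℂ) = 1 - 1 / 4 by norm_num,
    altTheta_one_sub]
  have e1 : exp (2 * Real.pi * I * (1 / 4) * ((((0 : Fin 2) : ℕ) : ℂ) + 1 / 2)) =
      exp (((Real.pi / 4 : ℝ) : ℂ) * I) := by
    rw [Fin.val_zero]; congr 1; push_cast; ring
  have e2 : exp (2 * Real.pi * I * (1 / 4) * ((((1 : Fin 2) : ℕ) : ℂ) + 1 / 2)) =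
      -exp (-(((Real.pi / 4 : ℝ) : ℂ) * I)) := by
    rw [Fin.val_one, neg_eq_neg_one_mul, ← exp_pi_mul_I, ← exp_add]
    congr 1; push_cast; ring
  have e3 := exp_mul_add_exp_neg (Real.pi / 4)
  rw [Real.cos_pi_div_four] at e3
  have e4 : ((Real.sqrt (1 / 2) : ℝ) : ℂ) * ((2 * (Real.sqrt 2 / 2) : ℝ) : ℂ) = 1 := by
    rw [← ofReal_mul, show 2 * (Real.sqrt 2 / 2) = Real.sqrt 2 by ring,
      ← Real.sqrt_mul (by norm_num)]
    norm_num
  rw [e1, e2]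
  linear_combination ((-I * τ) ^ (1 / 2 : ℂ) * altTheta (2 * τ) (1 / 4)) *
    (((Real.sqrt (1 / 2) : ℝ) : ℂ) * e3 + e4)

/-- Take `t = 2τ/11`, `N = 11`. Residues `b` and `10 - b` fold to a cosine, `b = 5` vanishes by
oddness about `1/2`, and five theta series remain. Oddness of `c` gives the phase condition. -/
lemma altTheta_eleven_neg_inv {τ : ℂ} (hτ : 0 < τ.im) {c : ℤ} (hc : Odd c) :
    altTheta (11 / 2 * (-1 / τ)) (c / 22) = (Real.sqrt (2 / 11) : ℂ) * (-I * τ) ^ (1 / 2 : ℂ) *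
      ∑ b : Fin 5, ((2 * Real.cos (c * (2 * (b : ℕ) + 1) * Real.pi / 22) : ℝ) : ℂ) *
        altTheta (22 * τ) ((2 * (b : ℕ) + 1) / 22) := by
  have hτ0 : τ ≠ 0 := by rintro rfl; simp at hτ
  have ht := im_mul_ofReal_pos hτ (show (0 : ℝ) < 2 / 11 by norm_num)
  have h := altTheta_neg_inv ht (c / 22)
  have hodd : exp (Real.pi * I * c) = -1 := by
    rw [← neg_one_zpow_eq_exp, hc.neg_one_zpow]
  rw [tsum_dualTerm ht 11 (by
    rw [← hodd]; congr 1; push_cast; ring)] at h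
  rw [show -1 / (((2 / 11 : ℝ) : ℂ) * τ) = 11 / 2 * (-1 / τ) by push_cast; field_simp] at h
  rw [h, show -I * (((2 / 11 : ℝ) : ℂ) * τ) = ((2 / 11 : ℝ) : ℂ) * (-I * τ) by ring,
    ofReal_mul_cpow_half (by norm_num) (mul_ne_zero (neg_ne_zero.mpr I_ne_zero) hτ0)]
  congr 1
  rw [show ((11 : ℕ) : ℂ) ^ 2 * (((2 / 11 : ℝ) : ℂ) * τ) = 22 * τ by push_cast; ring]
  have hpair : ∀ b b' : ℕ, b + b' = 10 →
      exp (2 * Real.pi * I * (c / 22) * ((b : ℂ) + 1 / 2)) *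
        altTheta (22 * τ) (((b : ℂ) + 1 / 2) / ((11 : ℕ) : ℂ)) +
      exp (2 * Real.pi * I * (c / 22) * ((b' : ℂ) + 1 / 2)) *
        altTheta (22 * τ) (((b' : ℂ) + 1 / 2) / ((11 : ℕ) : ℂ)) =
      ((2 * Real.cos (c * (2 * b + 1) * Real.pi / 22) : ℝ) : ℂ) *
        altTheta (22 * τ) ((2 * b + 1) / 22) := fun b b' hb => by
    have hb' : (b' : ℂ) = 10 - b := by rw [← Nat.cast_ofNat (n := 10), ← hb]; push_cast; ring
    rw [hb', show (((b : ℂ) + 1 / 2) / ((11 : ℕ) : ℂ)) = (2 * b + 1) / 22 by push_cast; ring,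
      show ((10 - (b : ℂ) + 1 / 2) / ((11 : ℕ) : ℂ)) = 1 - (2 * b + 1) / 22 by push_cast; ring,
      altTheta_one_sub, ← exp_mul_add_exp_neg]
    have e1 : exp (2 * Real.pi * I * (c / 22) * ((b : ℂ) + 1 / 2)) =
        exp (((c * (2 * b + 1) * Real.pi / 22 : ℝ) : ℂ) * I) := by
      congr 1; push_cast; ring
    have e2 : exp (2 * Real.pi * I * (c / 22) * (10 - (b : ℂ) + 1 / 2)) =
        -exp (-(((c * (2 * b + 1) * Real.pi / 22 : ℝ) : ℂ) * I)) := by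
      rw [neg_eq_neg_one_mul, ← hodd, ← exp_add]
      congr 1; push_cast; ring
    rw [e1, e2]
    ring
  have hmid : altTheta (22 * τ) ((((5 : ℕ) : ℂ) + 1 / 2) / ((11 : ℕ) : ℂ)) = 0 := by
    have h2 := altTheta_one_sub (22 * τ) (1 / 2)
    rw [show (1 : ℂ) - 1 / 2 = 1 / 2 by norm_num] at h2
    rw [show (((5 : ℕ) : ℂ) + 1 / 2) / ((11 : ℕ) : ℂ) = 1 / 2 by norm_num]
    linear_combination h2 / 2
  rw [Fin.sum_univ_eq_sum_range (fun b => exp (2 * Real.pi * I * (c / 22) * ((b : ℂ) + 1 / 2)) *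
    altTheta (22 * τ) (((b : ℂ) + 1 / 2) / ((11 : ℕ) : ℂ))) 11,
    Fin.sum_univ_eq_sum_range (fun b => ((2 * Real.cos (c * (2 * b + 1) * Real.pi / 22) : ℝ) : ℂ) *
        altTheta (22 * τ) ((2 * b + 1) / 22)) 5]
  simp only [Finset.sum_range_succ, Finset.sum_range_zero, zero_add]
  rw [hmid, ← hpair 0 10 rfl, ← hpair 1 9 rfl, ← hpair 2 8 rfl, ← hpair 3 7 rfl, ← hpair 4 6 rfl]
  ring

/-- A theta series in a power of `q`, normalised to `altTheta`. -/
lemma tsum_thetaTerm_mul_qpow (τ : ℂ) (s : ℚ) {A : ℤ} (B : ℤ) (hA : A ≠ 0) {e : ℚ}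
    (he : e = s * B ^ 2 / (4 * A)) {t x : ℂ} (ht : t = 2 * s * A * τ) (hx : x = B / (2 * A)) :
    (∑' r, thetaTerm (qpow τ s) A B r) * qpow τ e = altTheta t x := by
  have hA' : (A : ℂ) ≠ 0 := by exact_mod_cast hA
  unfold altTheta thetaTerm qpow
  rw [← tsum_mul_right]
  refine tsum_congr fun r => ?_
  rw [mul_assoc, ← exp_int_mul, ← exp_add, he, ht, hx]
  congr 2
  push_cast
  field_simp
  ring

end MizunoNahm
-- The vectors as theta quotients
namespace MizunoNahm
open Filter Topology Complex

lemma altTheta_quarter_eq (τ : ℂ) (s : ℚ) {t : ℂ} (ht : t = 4 * s * τ) :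
    (∑' r, thetaTerm (qpow τ s) 2 1 r) * qpow τ (s / 8) = altTheta t (1 / 4) :=
  tsum_thetaTerm_mul_qpow τ s 1 two_ne_zero (by push_cast; ring) (by rw [ht]; push_cast; ring)
    (by norm_num)

lemma qPochInf_mul_tsum_qpow {τ : ℂ} (hτ : 0 < τ.im) {s : ℚ} (hs : 0 < s) :
    qPochInf (-qpow τ s) (qpow τ s ^ 2) * (qPochInf (qpow τ s ^ 2) (qpow τ s ^ 2))⁻¹ *
      ∑' r, thetaTerm (qpow τ s) 2 1 r = 1 :=
  qPochInf_mul_tsum_thetaTerm (qpow_ne_zero τ s) (norm_qpow_lt_one hτ hs)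

/-- The series has the product prefactor as its inverse, so it cannot vanish. -/
lemma altTheta_quarter_ne_zero {τ : ℂ} (hτ : 0 < τ.im) {s : ℚ} (hs : 0 < s) {t : ℂ}
    (ht : t = 4 * s * τ) : altTheta t (1 / 4) ≠ 0 := by
  rw [← altTheta_quarter_eq τ s ht]
  exact mul_ne_zero (right_ne_zero_of_mul_eq_one (qPochInf_mul_tsum_qpow hτ hs))
    (qpow_ne_zero _ _)

/-- Product of the prefactor with a theta series, as a quotient of normalised theta series. -/
lemma qpow_mul_eq_altTheta_div {τ : ℂ} (hτ : 0 < τ.im) {s s' : ℚ} (hs : 0 < s) (c : ℤ) {r : ℚ}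
    (hr : r = s' * c ^ 2 / 44 - s / 8) {t t' : ℂ} (ht : t = 4 * s * τ) (ht' : t' = 22 * s' * τ) :
    qpow τ r * (qPochInf (-qpow τ s) (qpow τ s ^ 2) *
      ((qPochInf (qpow τ s ^ 2) (qpow τ s ^ 2))⁻¹ * ∑' n, thetaTerm (qpow τ s') 11 c n)) =
      altTheta t' (c / 22) / altTheta t (1 / 4) := by
  have hne := altTheta_quarter_ne_zero hτ hs ht
  have h1 := qPochInf_mul_tsum_qpow hτ hs
  have h2 := tsum_thetaTerm_mul_qpow τ s' c (A := 11) (by norm_num) (e := s' * c ^ 2 / 44)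
    (by push_cast; ring) (t := t') (x := c / 22) (by rw [ht']; push_cast; ring)
    (by push_cast; ring)
  have h3 := altTheta_quarter_eq τ s ht
  have h4 : qpow τ r * qpow τ (s / 8) = qpow τ (s' * c ^ 2 / 44) := by
    rw [qpow_mul_qpow, hr]; congr 1; ring
  rw [eq_div_iff hne, ← h2, ← h3, ← h4]
  linear_combination (qpow τ r * qpow τ (s / 8) * ∑' n, thetaTerm (qpow τ s') 11 c n) * h1

/-- The odd numbers `1, 3, 5, 7, 9` over `22`. -/
noncomputable def oddChar (i : Fin 5) : ℂ := (2 * (i : ℕ) + 1) / 22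

lemma U_eq {τ : ℂ} (hτ : 0 < τ.im) :
    U τ = fun i => altTheta (11 / 2 * τ) (oddChar i) / altTheta (2 * τ) (1 / 4) := by
  have h0 := qpow_ne_zero τ (1 / 4)
  have h1 := norm_qpow_lt_one hτ (show (0 : ℚ) < 1 / 4 by norm_num)
  have hp : qpow τ (1 / 2) = qpow τ (1 / 4) ^ 2 := qpow_eq_pow τ (by norm_num)
  have hq4 : qvar τ = qpow τ (1 / 4) ^ 4 := by
    rw [qvar_eq_qpow]; exact qpow_eq_pow τ (by norm_num)
  have hq2 : qvar τ = qpow τ (1 / 2) ^ 2 := by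
    rw [qvar_eq_qpow]; exact qpow_eq_pow τ (by norm_num)
  have hF := F_eq_baileyChain hτ
  have hG := inv_eq_baileySum_G h0 h1
  rw [← hp, ← hq4] at hG
  -- The product has base `q^(1/2)` and the theta series base `q^(1/4)`; completing both squares
  -- fixes the prefactor exponent as `c²/176 - 1/16`.
  have hf := fun (c : ℤ) (r : ℚ) (hr : r = (1 / 4 : ℚ) * c ^ 2 / 44 - (1 / 2 : ℚ) / 8) =>
    qpow_mul_eq_altTheta_div hτ (s := 1 / 2) (s' := 1 / 4) (by norm_num) c hr
      (t := 2 * τ) (t' := 11 / 2 * τ) (by push_cast; ring) (by push_cast; ring)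
  rw [← hq2] at hf
  have hb : ∀ k : ℕ, (qPoch (qvar τ ^ 2) (qvar τ ^ 2) k * qPoch (-qpow τ (1 / 2)) (qvar τ) k)⁻¹ =
      baileySum (qpow τ (1 / 4) ^ 4) 0 1 (thetaTerm (qpow τ (1 / 4)) 3 1) k := fun k => by
    rw [← hq4]; exact (hG k).1
  have hb' : ∀ k : ℕ, (qPoch (qvar τ ^ 2) (qvar τ ^ 2) k *
      qPoch (-qpow τ (1 / 2)) (qvar τ) (k + 1))⁻¹ =
      baileySum (qpow τ (1 / 4) ^ 4) 1 1 (thetaTerm (qpow τ (1 / 4)) 3 1) k := fun k => by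
    rw [← hq4]; exact (hG k).2
  have c00 := baileyChain_G_zero_zero h0 h1 hb
  have c01 := baileyChain_G_zero_one h0 h1 hb
  have c11 := baileyChain_G_one_one h0 h1 hb
  have c11' := baileyChain_G_one_one' h0 h1 hb'
  have c5 := baileyChain_G_add h0 h1 hb hb'
  rw [← hq4] at c00 c01 c11 c11' c5
  have f1 := hF 0 0 0
  have f2 := hF 0 0 1
  have f3 := hF 0 1 0
  have f3' := hF 1 2 1
  have f4 := hF 0 1 1
  have f5 := hF 1 1 1
  simp only [pow_zero, pow_one, add_zero, zero_add, Nat.reduceAdd] at f1 f2 f3 f3' f4 f5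
  funext i
  fin_cases i
  · simp only [U, oddChar]
    show qpow τ (-5 / 88) * F 1 1 1 τ = _
    rw [f1, c00, hf 1 (-5 / 88) (by norm_num)]
    norm_num
  · simp only [U, oddChar]
    show qpow τ (-1 / 88) * F 1 1 (qvar τ) τ = _
    rw [f2, c01, hf 3 (-1 / 88) (by norm_num)]
    norm_num
  · simp only [U, oddChar]
    show qpow τ (7 / 88) * (F 1 (qvar τ) (qvar τ) τ +
      qvar τ * F (qvar τ) (qvar τ ^ 2) (qvar τ ^ 3) τ) = _
    rw [f3, f3', mul_left_comm (qvar τ), ← mul_add, c5, hf 5 (7 / 88) (by norm_num)]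
    norm_num
  · simp only [U, oddChar]
    show qpow τ (19 / 88) * F 1 (qvar τ) (qvar τ ^ 2) τ = _
    rw [f4, c11, hf 7 (19 / 88) (by norm_num)]
    norm_num
  · simp only [U, oddChar]
    show qpow τ (35 / 88) * F (qvar τ) (qvar τ) (qvar τ ^ 2) τ = _
    rw [f5, c11', hf 9 (35 / 88) (by norm_num)]
    norm_num

lemma V_eq {τ : ℂ} (hτ : 0 < τ.im) :
    V τ = fun i => altTheta (44 * τ) (oddChar i) / altTheta (4 * τ) (1 / 4) := by
  have h0 := qpow_ne_zero τ 2
  have h1 := norm_qpow_lt_one hτ (show (0 : ℚ) < 2 by norm_num)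
  have hq2 : qvar τ ^ 2 = qpow τ 2 := by
    rw [qvar_eq_qpow]; exact (qpow_eq_pow τ (by norm_num)).symm
  have hq1 : qpow τ 1 = qvar τ := (qvar_eq_qpow τ).symm
  have hpow : ∀ (n : ℕ) (r s : ℚ), s = r + n → qpow τ r * qvar τ ^ n = qpow τ s := by
    intro n r s hs
    rw [qvar_eq_qpow, ← qpow_eq_pow τ (r := n) (by ring), qpow_mul_qpow, hs]
  have hf := fun (c : ℤ) (r : ℚ) (hr : r = (2 : ℚ) * c ^ 2 / 44 - (1 : ℚ) / 8) =>
    qpow_mul_eq_altTheta_div hτ (s := 1) (s' := 2) (by norm_num) c hr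
      (t := 4 * τ) (t' := 44 * τ) (by push_cast; ring) (by push_cast; ring)
  rw [hq1, hq2] at hf
  have hC := inv_eq_baileySum_C h0 h1
  have hG := G_eq_baileyChain hτ
  have hb : ∀ m : ℕ, (qPoch (qvar τ) (qvar τ) (2 * m + 0) *
      qPoch (-qvar τ) (qpow τ 2) (m + 0))⁻¹ = baileySum (qpow τ 2) 0 2
        (thetaTerm (qpow τ 2) 3 1) m := fun m => by
    rw [← hq2, inv_qPoch_two_mul, hq2]; exact (hC m).1
  have hb' : ∀ m : ℕ, (qPoch (qvar τ) (qvar τ) (2 * m + 1) *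
      qPoch (-qvar τ) (qpow τ 2) (m + 1))⁻¹ = baileySum (qpow τ 2) 1 2
        (thetaTerm (qpow τ 2) 3 1) m := fun m => by
    rw [← hq2, inv_qPoch_two_mul_add_one, hq2]; exact (hC m).2
  have c00 := baileyChain_C_zero_zero h0 h1 hb
  have c11 := baileyChain_C_one_one h0 h1 hb'
  have c22 := baileyChain_C_two_two h0 h1 hb'
  have c12 := baileyChain_C_one_two h0 h1 hb'
  have c3 := baileyChain_C_add h0 h1 hb hb'
  have g1 := hG 0 (by norm_num) 0 0
  have g3 := hG 0 (by norm_num) 0 1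
  have g3' := hG 1 (by norm_num) 1 2
  have g5 := hG 1 (by norm_num) 0 0
  have g7 := hG 1 (by norm_num) 0 1
  have g9 := hG 1 (by norm_num) 1 1
  rw [hq2] at g1 g3 g3' g5 g7 g9
  simp only [Nat.reduceAdd] at g1 g3 g3' g5 g7 g9
  rw [c00] at g1
  rw [c11] at g5
  rw [c12] at g7
  rw [c22] at g9
  simp only [mul_zero, mul_one, pow_zero, pow_one, one_mul, add_zero,
    Nat.reduceAdd, Nat.reducePow] at g1 g3 g3' g5 g7 g9 c3
  funext i
  fin_cases i
  · simp only [V, oddChar]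
    show qpow τ (-7 / 88) * G 0 1 1 1 τ = _
    rw [g1, hf 1 (-7 / 88) (by norm_num)]
    norm_num
  · simp only [V, oddChar]
    show qpow τ (25 / 88) * (G 0 (qvar τ) 1 1 τ + G 1 (qvar τ ^ 3) (qvar τ ^ 2) (qvar τ) τ) = _
    rw [hq2, g3, g3', mul_left_comm (qvar τ ^ 4), ← mul_add,
      show qvar τ ^ 4 = qpow τ 2 ^ 2 by rw [← hq2]; ring, c3, hf 3 (25 / 88) (by norm_num)]
    norm_num
  · simp only [V, oddChar]
    show qpow τ (1 / 88) * G 1 1 1 (qvar τ) τ = _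
    -- For odd parity the constant `q^(σ² + (b+c)σ)` of `G_eq_baileyChain` raises `1/88` to `89/88 =
    -- 5²/22 - 1/8`; the next two entries work likewise.
    rw [g5, ← mul_assoc, ← pow_one (qvar τ), hpow 1 _ (89 / 88) (by norm_num), pow_one,
      hf 5 (89 / 88) (by norm_num)]
    norm_num
  · simp only [V, oddChar]
    show qpow τ (9 / 88) * G 1 (qvar τ) 1 (qvar τ) τ = _
    rw [g7, ← mul_assoc, hpow 2 _ (185 / 88) (by norm_num), hf 7 (185 / 88) (by norm_num)]
    norm_num
  · simp only [V, oddChar]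
    show qpow τ (49 / 88) * G 1 (qvar τ ^ 2) (qvar τ ^ 2) (qvar τ) τ = _
    rw [hq2, g9, ← mul_assoc, hpow 3 _ (313 / 88) (by norm_num), hf 9 (313 / 88) (by norm_num)]
    norm_num

end MizunoNahm
-- The cosine matrix and the two transformation formulas
namespace MizunoNahm
open Filter Topology Complex

lemma sqrt_mul_cos_eq_alpha {m : ℤ} {k : ℕ} (j : ℤ)
    (h : m = 11 - 2 * k + 22 * j ∨ m = -(11 - 2 * k) + 22 * j) :
    ((Real.sqrt (2 / 11) * Real.cos (m * Real.pi / 22) : ℝ) : ℂ) = (-1) ^ j * α k := by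
  have e : Real.cos (m * Real.pi / 22) = (-1) ^ j * Real.sin (k * Real.pi / 11) := by
    rw [← Real.cos_pi_div_two_sub]
    rcases h with rfl | rfl
    · rw [← Real.cos_add_int_mul_pi]
      congr 1; push_cast; ring
    · rw [← Real.cos_neg (Real.pi / 2 - _), ← Real.cos_add_int_mul_pi]
      congr 1; push_cast; ring
  rw [e, α]
  push_cast
  ring

/-- `S` is a discrete cosine kernel on the odd residues `1, …, 9`; its signs record the reduction of
the product of two residues modulo 22. -/
lemma S_apply (i j : Fin 5) : S i j = ((Real.sqrt (2 / 11) *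
    Real.cos (((2 * (i : ℕ) + 1 : ℤ) * (2 * (j : ℕ) + 1) : ℤ) * Real.pi / 22) : ℝ) : ℂ) := by
  fin_cases i <;> fin_cases j
  · exact .trans (by simp [S]) (sqrt_mul_cos_eq_alpha (m := 1) (k := 5) 0 (by norm_num)).symm
  · exact .trans (by simp [S]) (sqrt_mul_cos_eq_alpha (m := 3) (k := 4) 0 (by norm_num)).symm
  · exact .trans (by simp [S]) (sqrt_mul_cos_eq_alpha (m := 5) (k := 3) 0 (by norm_num)).symm
  · exact .trans (by simp [S]) (sqrt_mul_cos_eq_alpha (m := 7) (k := 2) 0 (by norm_num)).symm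
  · exact .trans (by simp [S]) (sqrt_mul_cos_eq_alpha (m := 9) (k := 1) 0 (by norm_num)).symm
  · exact .trans (by simp [S]) (sqrt_mul_cos_eq_alpha (m := 3) (k := 4) 0 (by norm_num)).symm
  · exact .trans (by simp [S]) (sqrt_mul_cos_eq_alpha (m := 9) (k := 1) 0 (by norm_num)).symm
  · exact .trans (by simp [S]) (sqrt_mul_cos_eq_alpha (m := 15) (k := 2) 1 (by norm_num)).symm
  · exact .trans (by simp [S]) (sqrt_mul_cos_eq_alpha (m := 21) (k := 5) 1 (by norm_num)).symm
  · exact .trans (by simp [S]) (sqrt_mul_cos_eq_alpha (m := 27) (k := 3) 1 (by norm_num)).symm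
  · exact .trans (by simp [S]) (sqrt_mul_cos_eq_alpha (m := 5) (k := 3) 0 (by norm_num)).symm
  · exact .trans (by simp [S]) (sqrt_mul_cos_eq_alpha (m := 15) (k := 2) 1 (by norm_num)).symm
  · exact .trans (by simp [S]) (sqrt_mul_cos_eq_alpha (m := 25) (k := 4) 1 (by norm_num)).symm
  · exact .trans (by simp [S]) (sqrt_mul_cos_eq_alpha (m := 35) (k := 1) 2 (by norm_num)).symm
  · exact .trans (by simp [S]) (sqrt_mul_cos_eq_alpha (m := 45) (k := 5) 2 (by norm_num)).symm
  · exact .trans (by simp [S]) (sqrt_mul_cos_eq_alpha (m := 7) (k := 2) 0 (by norm_num)).symm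
  · exact .trans (by simp [S]) (sqrt_mul_cos_eq_alpha (m := 21) (k := 5) 1 (by norm_num)).symm
  · exact .trans (by simp [S]) (sqrt_mul_cos_eq_alpha (m := 35) (k := 1) 2 (by norm_num)).symm
  · exact .trans (by simp [S]) (sqrt_mul_cos_eq_alpha (m := 49) (k := 3) 2 (by norm_num)).symm
  · exact .trans (by simp [S]; norm_num) (sqrt_mul_cos_eq_alpha (m := 63) (k := 4) 3 (by norm_num)).symm
  · exact .trans (by simp [S]) (sqrt_mul_cos_eq_alpha (m := 9) (k := 1) 0 (by norm_num)).symm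
  · exact .trans (by simp [S]) (sqrt_mul_cos_eq_alpha (m := 27) (k := 3) 1 (by norm_num)).symm
  · exact .trans (by simp [S]) (sqrt_mul_cos_eq_alpha (m := 45) (k := 5) 2 (by norm_num)).symm
  · exact .trans (by simp [S]; norm_num) (sqrt_mul_cos_eq_alpha (m := 63) (k := 4) 3 (by norm_num)).symm
  · exact .trans (by simp [S]; norm_num) (sqrt_mul_cos_eq_alpha (m := 81) (k := 2) 4 (by norm_num)).symm

/-- `cos (k π / 11)` as a complex number. -/
noncomputable def cosEleven (k : ℤ) : ℂ := ((Real.cos (k * Real.pi / 11) : ℝ) : ℂ)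

lemma cosEleven_sub (k : ℤ) : cosEleven (11 - k) = -cosEleven k := by
  unfold cosEleven
  rw [← ofReal_neg, ← Real.cos_pi_sub]
  congr 2; push_cast; ring

lemma cosEleven_zero : cosEleven 0 = 1 := by simp [cosEleven]

lemma alpha_mul_alpha (i j : ℕ) :
    α i * α j = (cosEleven (i - j) - cosEleven (i + j)) / 11 := by
  have h1 := Real.cos_sub (i * Real.pi / 11) (j * Real.pi / 11)
  have h2 := Real.cos_add (i * Real.pi / 11) (j * Real.pi / 11)
  have h3 : Real.sqrt (2 / 11) * Real.sqrt (2 / 11) = 2 / 11 :=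
    Real.mul_self_sqrt (by norm_num)
  have h4 : cosEleven (i - j) = ((Real.cos (i * Real.pi / 11 - j * Real.pi / 11) : ℝ) : ℂ) := by
    unfold cosEleven; congr 2; push_cast; ring
  have h5 : cosEleven (i + j) = ((Real.cos (i * Real.pi / 11 + j * Real.pi / 11) : ℝ) : ℂ) := by
    unfold cosEleven; congr 2; push_cast; ring
  rw [h4, h5, α, α, ← ofReal_mul, ← ofReal_sub, h1, h2, ← ofReal_ofNat, ← ofReal_div]
  congr 1
  linear_combination (Real.sin (i * Real.pi / 11) * Real.sin (j * Real.pi / 11)) * h3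

/-- Multiplication by `2 cos(π/22)` makes the sum telescope, down to `cos(π/22)` and `cos(π/2) = 0`.
-/
lemma cosEleven_alternating :
    cosEleven 1 - cosEleven 2 + cosEleven 3 - cosEleven 4 + cosEleven 5 = 1 / 2 := by
  have hpi := Real.pi_pos
  have hne : Real.cos (Real.pi / 22) ≠ 0 :=
    (Real.cos_pos_of_mem_Ioo ⟨by linarith, by linarith⟩).ne'
  have hp : ∀ k : ℝ, 2 * Real.cos (Real.pi / 22) * Real.cos (k * Real.pi / 11) =
      Real.cos ((2 * k - 1) * Real.pi / 22) + Real.cos ((2 * k + 1) * Real.pi / 22) := fun k => by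
    rw [show (2 * k - 1) * Real.pi / 22 = k * Real.pi / 11 - Real.pi / 22 by ring,
      show (2 * k + 1) * Real.pi / 22 = k * Real.pi / 11 + Real.pi / 22 by ring,
      Real.cos_sub, Real.cos_add]
    ring
  have h1 := hp 1
  have h2 := hp 2
  have h3 := hp 3
  have h4 := hp 4
  have h5 := hp 5
  norm_num at h1 h2 h3 h4 h5
  have h11 : Real.cos (11 * Real.pi / 22) = 0 := by
    rw [show 11 * Real.pi / 22 = Real.pi / 2 by ring, Real.cos_pi_div_two]
  have h : Real.cos (1 * Real.pi / 11) - Real.cos (2 * Real.pi / 11) +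
      Real.cos (3 * Real.pi / 11) - Real.cos (4 * Real.pi / 11) + Real.cos (5 * Real.pi / 11) =
      1 / 2 := by
    apply mul_left_cancel₀ (mul_ne_zero two_ne_zero hne)
    rw [one_mul]
    linear_combination h1 - h2 + h3 - h4 + h5 + h11
  unfold cosEleven
  have h' := congrArg ofReal h
  push_cast at h' ⊢
  exact h'

/-- Product-to-sum formulas and `cos(π - x) = -cos x` reduce every entry to a linear form in
`cosEleven 1, …, cosEleven 5`; the alternating sum eliminates the last of these. -/
lemma S_mul_two_smul_S : S * ((2 : ℂ) • S) = 1 := by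
  have h := cosEleven_alternating
  have h0 := cosEleven_zero
  have c6 : cosEleven 6 = -cosEleven 5 := cosEleven_sub 5
  have c7 : cosEleven 7 = -cosEleven 4 := cosEleven_sub 4
  have c8 : cosEleven 8 = -cosEleven 3 := cosEleven_sub 3
  have c9 : cosEleven 9 = -cosEleven 2 := cosEleven_sub 2
  have c10 : cosEleven 10 = -cosEleven 1 := cosEleven_sub 1
  have hneg : ∀ k, cosEleven (-k) = cosEleven k := fun k => by
    unfold cosEleven
    rw [← Real.cos_neg]
    congr 2; push_cast; ring
  have h5 : cosEleven 5 =
      1 / 2 - cosEleven 1 + cosEleven 2 - cosEleven 3 + cosEleven 4 := by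
    linear_combination h
  ext i j
  fin_cases i <;> fin_cases j <;>
    simp [S, Matrix.mul_apply, Fin.sum_univ_five, mul_left_comm _ (2 : ℂ), alpha_mul_alpha] <;>
    norm_num [h0, c6, c7, c8, c9, c10, hneg, h5] <;> ring

/-- Numerator and denominator acquire the same factor `(-iτ)^(1/2)`, which cancels; the factor 2
comes from folding the residues in pairs. -/
lemma U_neg_inv {τ : ℂ} (hτ : 0 < τ.im) : U (-1 / τ) = ((2 : ℂ) • S) *ᵥ V (τ / 2) := by
  have hτ0 : τ ≠ 0 := by rintro rfl; simp at hτ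
  have hτ' : 0 < (-1 / τ).im := by
    rw [neg_div, one_div, neg_im, inv_im, neg_div, neg_neg]
    exact div_pos hτ (normSq_pos.mpr hτ0)
  have hτ2 : 0 < (τ / 2).im := by simpa using hτ
  have hc : (-I * τ) ^ (1 / 2 : ℂ) ≠ 0 := by
    rw [Ne, cpow_eq_zero_iff]; simp [hτ0]
  rw [U_eq hτ', V_eq hτ2]
  funext i
  have hT := altTheta_quarter_ne_zero hτ (s := 1 / 2) (by norm_num) (t := 2 * τ)
    (by push_cast; ring)
  have h11 := altTheta_eleven_neg_inv hτ (c := 2 * (i : ℕ) + 1) ⟨(i : ℕ), rfl⟩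
  have hi : oddChar i = (((2 * (i : ℕ) + 1 : ℤ) : ℤ) : ℂ) / 22 := by
    unfold oddChar; push_cast; ring
  rw [altTheta_two_neg_inv hτ, hi, h11, mul_comm (Real.sqrt (2 / 11) : ℂ), mul_assoc,
    mul_div_mul_left _ _ hc, show 44 * (τ / 2) = 22 * τ by ring,
    show 4 * (τ / 2) = 2 * τ by ring, Matrix.smul_mulVec, Pi.smul_apply, Matrix.mulVec,
    dotProduct, smul_eq_mul, Finset.mul_sum, Finset.mul_sum, Finset.sum_div]
  refine Finset.sum_congr rfl fun j _ => ?_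
  rw [S_apply, oddChar]
  push_cast
  ring

/-- The formula for `U` at `-1/τ`, multiplied by `S`. -/
lemma V_neg_inv {τ : ℂ} (hτ : 0 < τ.im) : V (-1 / (2 * τ)) = S *ᵥ U τ := by
  have hτ0 : τ ≠ 0 := by rintro rfl; simp at hτ
  have hτ' : 0 < (-1 / τ).im := by
    rw [neg_div, one_div, neg_im, inv_im, neg_div, neg_neg]
    exact div_pos hτ (normSq_pos.mpr hτ0)
  have h := U_neg_inv hτ'
  rw [show -1 / (-1 / τ) = τ by field_simp, show -1 / τ / 2 = -1 / (2 * τ) by field_simp] at h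
  rw [h, Matrix.mulVec_mulVec, S_mul_two_smul_S, Matrix.one_mulVec]

end MizunoNahm

theorem theorem1p5 :
    -- on the upper half-plane the series defining `F` and `G_σ` converge absolutely,
    (∀ u v w τ : ℂ, 0 < τ.im →
      Summable (MizunoNahm.termF u v w τ) ∧ Summable (MizunoNahm.termG u v w τ)) ∧
    -- and the two transformation formulas hold there.
    (∀ τ : ℂ, 0 < τ.im →
      MizunoNahm.V (-1 / (2 * τ)) = MizunoNahm.S *ᵥ MizunoNahm.U τ ∧
      MizunoNahm.U (-1 / τ) = ((2 : ℂ) • MizunoNahm.S) *ᵥ MizunoNahm.V (τ / 2)) :=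
  ⟨fun u v w _ hτ => ⟨MizunoNahm.summable_termF u v w hτ, MizunoNahm.summable_termG u v w hτ⟩,
    fun _ hτ => ⟨MizunoNahm.V_neg_inv hτ, MizunoNahm.U_neg_inv hτ⟩⟩
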